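/- Notation. $\mathbb N=\{1,2,\dots\}$, $\mathbb T$ is the unit circle in $\mathbb C$, and $e(t)=e^{2\pi i t}$ for $t\in\mathbb R$. Let $B$ be the ring of germs at $+\infty$ of continuous real functions: functions continuous on some half-line $[t_0,\infty)$, two of them being identified if they agree for all large $t$. A Hardy field is a subfield of $B$ that is closed under differentiation, and $U$ is the union of all Hardy fields. For eventually positive functions $f,g$, write $f\prec g$ if $\lim_{t\to\infty} f(t)/g(t)=0$. A set $A\subset\mathbb N$ has density $d$ if $\lim_{N\to\infty}\frac1N|A\cap\{1,\dots,N\}|=d$. It is called regular if it has a positive density and, for every $K\in\mathbb N$ and every $B_0\subset\{0,\dots,K\}$, the set $$\{n\in\mathbb N:\ \text{for all } j\in\{0,\dots,K\},\ n+j\in A \text{ if and only if } j\in B_0\}$$ has a density (possibly $0$). A function $g\in B$ satisfies property (Q) if the set $\{n\in\mathbb N: e(g(n))\in I\}$ is regular for every nondegenerate interval $I\subset\mathbb T$, that is, for every $I=\{e(s): s\in J\}$ where $J\subset\mathbb R$ is an interval (open, closed or half-open) with more than one point. (Regularity is not affected by the finitely many $n$ at which $g$ may be undefined.) Theorem. Let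 $l\in\{0,1,2,\dots\}$ and let $g\in U$ be eventually positive with $$t^l\ln t\ \prec\ g\ \prec\ t^{l+1}.$$ Then $g$ satisfies property (Q). -/

import Mathlib

open Filter Topology

noncomputable section

/-- The ring `B` of germs at `+∞` of continuous real functions: the germs having a representative
that is continuous on some half-line `[t₀, ∞)`. The ring operations are the pointwise ones. -/
def continuousGerms : Subring (Germ (atTop : Filter ℝ) ℝ) where
  carrier := {φ | ∃ (f : ℝ → ℝ) (t₀ : ℝ), ContinuousOn f (Set.Ici t₀) ∧ φ = (f : Germ atTop ℝ)}
  mul_mem' := by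
    rintro _ _ ⟨f, a, hf, rfl⟩ ⟨g, b, hg, rfl⟩
    exact ⟨f * g, max a b, (hf.mono (Set.Ici_subset_Ici.2 (le_max_left a b))).mul
      (hg.mono (Set.Ici_subset_Ici.2 (le_max_right a b))), rfl⟩
  one_mem' := ⟨1, 0, continuousOn_const, rfl⟩
  add_mem' := by
    rintro _ _ ⟨f, a, hf, rfl⟩ ⟨g, b, hg, rfl⟩
    exact ⟨f + g, max a b, (hf.mono (Set.Ici_subset_Ici.2 (le_max_left a b))).add
      (hg.mono (Set.Ici_subset_Ici.2 (le_max_right a b))), rfl⟩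
  zero_mem' := ⟨0, 0, continuousOn_const, rfl⟩
  neg_mem' := by
    rintro _ ⟨f, a, hf, rfl⟩
    exact ⟨-f, a, hf.neg, rfl⟩

/-- The germ `ψ` is the derivative of the germ `φ`. Since two functions with the same germ at `+∞`
agree on an open half-line, this does not depend on the representatives. -/
def IsGermDeriv (φ ψ : Germ (atTop : Filter ℝ) ℝ) : Prop :=
  ∃ f f' : ℝ → ℝ, φ = (f : Germ atTop ℝ) ∧ ψ = (f' : Germ atTop ℝ) ∧
    ∀ᶠ t in atTop, HasDerivAt f (f' t) t

/-- A Hardy field: a subring of the ring of germs of continuous functions which is a field and is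
closed under differentiation (every element is differentiable, with derivative in the field). -/
structure IsHardyField (H : Subring (Germ (atTop : Filter ℝ) ℝ)) : Prop where
  le_continuousGerms : H ≤ continuousGerms
  isField : IsField H
  deriv_mem : ∀ φ ∈ H, ∃ ψ ∈ H, IsGermDeriv φ ψ

/-- `U`: the union of all Hardy fields. -/
def hardyGerms : Set (Germ (atTop : Filter ℝ) ℝ) :=
  {φ | ∃ H : Subring (Germ (atTop : Filter ℝ) ℝ), IsHardyField H ∧ φ ∈ H}

/-- `f ≺ g`, used for eventually positive functions: `f(t) / g(t) → 0` as `t → ∞`. -/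
def GrowsSlower (f g : ℝ → ℝ) : Prop :=
  Tendsto (fun t => f t / g t) atTop (𝓝 0)

/-- The class `M_l`: eventually positive Hardy functions with `t ^ l * ln t ≺ g ≺ t ^ (l + 1)`.
A function `g : ℝ → ℝ` stands for its germ at `+∞`: all conditions depend only on this germ. -/
def HardyClassM (l : ℕ) : Set (ℝ → ℝ) :=
  {g | (g : Germ (atTop : Filter ℝ) ℝ) ∈ hardyGerms ∧ (∀ᶠ t in atTop, 0 < g t) ∧
    GrowsSlower (fun t => t ^ l * Real.log t) g ∧ GrowsSlower g (fun t => t ^ (l + 1))}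

/-- The set `A` of positive integers has density `d`: `|A ∩ {1, …, N}| / N → d`.
(Whether `0 ∈ A` is irrelevant.) -/
def HasDensity (A : Set ℕ) (d : ℝ) : Prop :=
  Tendsto (fun N : ℕ => ((A ∩ Set.Icc 1 N).ncard : ℝ) / (N : ℝ)) atTop (𝓝 d)

/-- Regular sets of positive integers: the density exists and is positive, and the places where any
given finite 0-1-word starts in the indicator sequence of `A` form a set having a density. -/
def IsRegularSet (A : Set ℕ) : Prop :=
  (∃ d : ℝ, 0 < d ∧ HasDensity A d) ∧
    ∀ (K : ℕ) (B : Set ℕ), B ⊆ Set.Icc 0 K →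
      ∃ d : ℝ, HasDensity {n : ℕ | ∀ j ∈ Set.Icc 0 K, (n + j ∈ A ↔ j ∈ B)} d

/-- `e(t) = exp(2πit)`, as a point of the unit circle. -/
def circleE (t : ℝ) : Circle := Circle.exp (2 * Real.pi * t)

/-- Nondegenerate intervals of the unit circle: images under `e` of intervals of the real line
(with or without endpoints) having more than one point. The whole circle is included. -/
def IsCircleInterval (I : Set Circle) : Prop :=
  ∃ J : Set ℝ, J.OrdConnected ∧ J.Nontrivial ∧ I = circleE '' J

/-- Property (Q): for each interval `I` of the circle, `{n : e(g(n)) ∈ I}` is regular. -/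
def PropertyQ (g : ℝ → ℝ) : Prop :=
  ∀ I : Set Circle, IsCircleInterval I → IsRegularSet {n : ℕ | circleE (g n) ∈ I}

end

/-! Write `m = l + 1`, let `f m` be the `m`-th derivative of `g`, and let `S` be the shift on
sequences. Pattern frequencies are governed by the Weyl sums of windows `(g(n), …, g(n + K))`, whose
phases are `P(S) g` for polynomials `P`. The point is that every such sum has a limit.

The growth bounds and Hardy field rigidity give `f m → 0` and `t * |f m t| → ∞`, and, up to sign, `f
m` is positive, decreasing and convex near infinity. The mean value theorem transfers this to `u =
Δ^m g`, up to sign and a shift of the index (`HardyClassM.exists_isConvexDecay`).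

Now factor `P = (X - 1)^i * Q` with `Q(1) ≠ 0`. If `i < m`, then `Δ^(m - i) P(S) g = Q(S) u`, which
is asymptotic to `Q(1) u`; van der Corput's theorem, used `m - i - 1` times, reduces the sum to
Fejér's theorem and the mean is `0`. If `i ≥ m`, then `P(S) g` is a polynomial in `S` applied to
`u`, so it tends to `0` and the mean is `1` (`IsConvexDecay.exists_tendsto_cesaroMean_expChar`).

Hence averages of continuous functions along the windows converge on the torus, and a single
coordinate is equidistributed on the circle. Since an arc has null boundary, equidistribution
controls the error of replacing its indicator by a continuous function, so pattern frequencies exist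
(`exists_tendsto_cesaroMean_pattern`). The density is positive because an arc has interior. -/

/-! ### Cesàro means -/

/-- The averages `(f 0 + ⋯ + f (N - 1)) / N`. -/
noncomputable def cesaroMean {E : Type*} [NormedAddCommGroup E] [NormedSpace ℝ E] (f : ℕ → E)
    (N : ℕ) : E :=
  (N : ℝ)⁻¹ • ∑ n ∈ Finset.range N, f n

section CesaroMean

variable {E : Type*} [NormedAddCommGroup E] [NormedSpace ℝ E]

theorem norm_cesaroMean_le {f : ℕ → E} {C : ℝ} (hC : 0 ≤ C) (hf : ∀ n, ‖f n‖ ≤ C) (N : ℕ) :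
    ‖cesaroMean f N‖ ≤ C := by
  rcases Nat.eq_zero_or_pos N with rfl | hN
  · simpa [cesaroMean] using hC
  have hN' : (0 : ℝ) < N := by exact_mod_cast hN
  rw [cesaroMean, norm_smul, norm_inv, Real.norm_natCast, inv_mul_le_iff₀ hN']
  calc ‖∑ n ∈ Finset.range N, f n‖ ≤ ∑ n ∈ Finset.range N, C :=
        norm_sum_le_of_le _ fun n _ => hf n
    _ = N * C := by simp

theorem cesaroMean_sub (f g : ℕ → E) (N : ℕ) :
    cesaroMean (fun n => f n - g n) N = cesaroMean f N - cesaroMean g N := by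
  simp [cesaroMean, smul_sub]

theorem cesaroMean_sum {ι : Type*} (s : Finset ι) (f : ι → ℕ → E) (N : ℕ) :
    cesaroMean (fun n => ∑ i ∈ s, f i n) N = ∑ i ∈ s, cesaroMean (f i) N := by
  simp only [cesaroMean]
  rw [Finset.sum_comm, Finset.smul_sum]

theorem norm_cesaroMean_shift_sub_le {f : ℕ → E} {C : ℝ} (hf : ∀ n, ‖f n‖ ≤ C) (M N : ℕ) :
    ‖cesaroMean (fun n => f (n + M)) N - cesaroMean f N‖ ≤ (N : ℝ)⁻¹ * (2 * M * C) := by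
  have h : ∑ n ∈ Finset.range N, f (n + M) - ∑ n ∈ Finset.range N, f n
      = ∑ n ∈ Finset.range M, f (N + n) - ∑ n ∈ Finset.range M, f n := by
    have h1 := Finset.sum_range_add f N M
    have h2 := Finset.sum_range_add f M N
    rw [add_comm M N, h1] at h2
    simp only [add_comm _ M]
    rw [sub_eq_sub_iff_add_eq_add, add_comm, ← h2, add_comm]
  rw [cesaroMean, cesaroMean, ← smul_sub, h, norm_smul, norm_inv, Real.norm_natCast]
  gcongr
  calc _ ≤ ‖∑ n ∈ Finset.range M, f (N + n)‖ + ‖∑ n ∈ Finset.range M, f n‖ := norm_sub_le _ _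
    _ ≤ ∑ n ∈ Finset.range M, C + ∑ n ∈ Finset.range M, C :=
        add_le_add (norm_sum_le_of_le _ fun n _ => hf _) (norm_sum_le_of_le _ fun n _ => hf _)
    _ = 2 * M * C := by simp; ring

theorem tendsto_cesaroMean_shift_sub {f : ℕ → E} {C : ℝ} (hf : ∀ n, ‖f n‖ ≤ C) (M : ℕ) :
    Tendsto (fun N => cesaroMean (fun n => f (n + M)) N - cesaroMean f N) atTop (𝓝 0) := by
  refine squeeze_zero_norm (norm_cesaroMean_shift_sub_le hf M) ?_
  simpa using (tendsto_inv_atTop_nhds_zero_nat (𝕜 := ℝ)).mul_const (2 * M * C)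

theorem tendsto_cesaroMean_shift_iff {f : ℕ → E} {C : ℝ} (hf : ∀ n, ‖f n‖ ≤ C) (M : ℕ) (L : E) :
    Tendsto (cesaroMean fun n => f (n + M)) atTop (𝓝 L) ↔ Tendsto (cesaroMean f) atTop (𝓝 L) := by
  have h := tendsto_cesaroMean_shift_sub hf M
  constructor
  · intro h1
    simpa using h1.sub h
  · intro h1
    simpa using h.add h1

theorem Filter.Tendsto.cesaroMean {f : ℕ → E} {L : E} (hf : Tendsto f atTop (𝓝 L)) :
    Tendsto (cesaroMean f) atTop (𝓝 L) :=
  hf.cesaro_smul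

/-- The block sums `f n + ⋯ + f (n + H - 1)` have the same Cesàro behaviour as `H • f`. -/
theorem tendsto_cesaroMean_block_sub {f : ℕ → E} {C : ℝ} (hf : ∀ n, ‖f n‖ ≤ C) (H : ℕ) :
    Tendsto (fun N => cesaroMean (fun n => ∑ h ∈ Finset.range H, f (n + h)) N
      - (H : ℝ) • cesaroMean f N) atTop (𝓝 0) := by
  have h := tendsto_finsetSum (Finset.range H) fun h _ => tendsto_cesaroMean_shift_sub hf h
  simp only [Finset.sum_const_zero, Finset.sum_sub_distrib, Finset.sum_const,
    Finset.card_range] at h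
  refine h.congr fun N => ?_
  rw [cesaroMean_sum, Nat.cast_smul_eq_nsmul]

end CesaroMean

/-! ### Van der Corput's inequality -/

theorem norm_cesaroMean_sq_le (f : ℕ → ℂ) (N : ℕ) :
    ‖cesaroMean f N‖ ^ 2 ≤ cesaroMean (fun n => ‖f n‖ ^ 2) N := by
  rcases Nat.eq_zero_or_pos N with rfl | hN
  · simp [cesaroMean]
  have hN' : (0 : ℝ) < N := by exact_mod_cast hN
  have h1 : ‖∑ n ∈ Finset.range N, f n‖ ^ 2 ≤ N * ∑ n ∈ Finset.range N, ‖f n‖ ^ 2 := by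
    calc ‖∑ n ∈ Finset.range N, f n‖ ^ 2 ≤ (∑ n ∈ Finset.range N, ‖f n‖) ^ 2 := by
          gcongr; exact norm_sum_le _ _
      _ ≤ _ := by simpa using sq_sum_le_card_mul_sum_sq (s := Finset.range N) (f := fun n => ‖f n‖)
  rw [cesaroMean, cesaroMean, norm_smul, norm_inv, Real.norm_natCast, mul_pow, smul_eq_mul]
  calc _ ≤ ((N : ℝ)⁻¹) ^ 2 * (N * ∑ n ∈ Finset.range N, ‖f n‖ ^ 2) := by gcongr
    _ = _ := by field_simp

open ComplexConjugate in
/-- Van der Corput's difference theorem, for unimodular sequences. -/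
theorem tendsto_cesaroMean_of_vanDerCorput {z : ℕ → ℂ} (hz : ∀ n, ‖z n‖ = 1)
    (h : ∀ k : ℕ, 1 ≤ k → Tendsto (cesaroMean fun n => z (n + k) * conj (z n)) atTop (𝓝 0)) :
    Tendsto (cesaroMean z) atTop (𝓝 0) := by
  -- In the mean, distinct shifts of `z` are orthonormal, so a block of `H` consecutive terms has
  -- mean square `H` rather than `H ^ 2`.
  have hcorr : ∀ i j : ℕ, Tendsto (cesaroMean fun n => z (n + i) * conj (z (n + j))) atTop
      (𝓝 (if i = j then 1 else 0)) := by
    intro i j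
    rcases lt_trichotomy i j with hij | rfl | hij
    · obtain ⟨k, rfl⟩ := Nat.exists_eq_add_of_lt hij
      rw [if_neg (by omega)]
      have h1 := (Complex.continuous_conj.tendsto _).comp (h (k + 1) (by omega))
      have h2 : (⇑(starRingEnd ℂ) ∘ cesaroMean fun n => z (n + (k + 1)) * conj (z n))
          = cesaroMean fun n => z n * conj (z (n + (k + 1))) := by
        ext N
        simp [cesaroMean, mul_comm]
      rw [h2, map_zero] at h1
      have h3 := (tendsto_cesaroMean_shift_iff (C := 1) (by intro n; simp [hz]) i 0).2 h1
      refine h3.congr fun N => ?_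
      congr 1
      ext n
      rw [show n + (i + k + 1) = n + i + (k + 1) by ring]
    · simp only [Complex.mul_conj, Complex.normSq_eq_norm_sq, hz, if_true]
      exact Tendsto.cesaroMean (by simp)
    · obtain ⟨k, rfl⟩ := Nat.exists_eq_add_of_lt hij
      rw [if_neg (by omega)]
      have h3 := (tendsto_cesaroMean_shift_iff (C := 1) (by intro n; simp [hz]) j 0).2
        (h (k + 1) (by omega))
      refine h3.congr fun N => ?_
      congr 1
      ext n
      rw [show n + (j + k + 1) = n + j + (k + 1) by ring]
  have hblock : ∀ H : ℕ, Tendsto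
      (cesaroMean fun n => ‖∑ i ∈ Finset.range H, z (n + i)‖ ^ 2) atTop (𝓝 (H : ℝ)) := by
    intro H
    have h1 := tendsto_finsetSum (Finset.range H) fun i _ =>
      tendsto_finsetSum (Finset.range H) fun j _ => hcorr i j
    simp only [← cesaroMean_sum] at h1
    have h2 : ∑ i ∈ Finset.range H, ∑ j ∈ Finset.range H, (if i = j then (1 : ℂ) else 0) = H := by
      simp +contextual
    rw [h2] at h1
    have h3 := (Complex.continuous_re.tendsto _).comp h1
    simp only [Complex.natCast_re] at h3
    refine h3.congr fun N => ?_
    simp only [Function.comp, cesaroMean, Complex.smul_re, Complex.re_sum]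
    congr 1
    refine Finset.sum_congr rfl fun n _ => ?_
    rw [← Complex.normSq_eq_norm_sq, ← Complex.ofReal_re (Complex.normSq _), ← Complex.mul_conj,
      map_sum, Finset.sum_mul_sum, Complex.re_sum]
    simp only [Complex.re_sum]
  rw [Metric.tendsto_atTop']
  intro ε hε
  -- Block sums have mean square below `2 * H` eventually; this is at most `(H * (ε / 2)) ^ 2` once
  -- `H ≥ 8 / ε ^ 2`.
  obtain ⟨H, hH⟩ := exists_nat_gt (8 / ε ^ 2)
  have hH0 : (0 : ℝ) < H := lt_trans (by positivity) hH
  have h1 := tendsto_cesaroMean_block_sub (f := z) (C := 1) (fun n => (hz n).le) H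
  have h2 : ∀ᶠ N in atTop, ‖cesaroMean (fun n => ∑ h ∈ Finset.range H, z (n + h)) N
      - (H : ℝ) • cesaroMean z N‖ < H * (ε / 2) := by
    have := h1.norm
    rw [norm_zero] at this
    exact this.eventually_lt_const (by positivity)
  have h3 := (hblock H).eventually_lt_const (show (H : ℝ) < 2 * H by linarith)
  obtain ⟨N₀, hN₀⟩ := eventually_atTop.1 (h2.and h3)
  refine ⟨N₀, fun N hN => ?_⟩
  obtain ⟨h4, h5⟩ := hN₀ N hN.le
  rw [dist_zero_right]
  have h6 := norm_cesaroMean_sq_le (fun n => ∑ h ∈ Finset.range H, z (n + h)) N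
  have h7 : ‖cesaroMean (fun n => ∑ h ∈ Finset.range H, z (n + h)) N‖ < H * (ε / 2) := by
    refine lt_of_pow_lt_pow_left₀ 2 (by positivity) ?_
    rw [div_lt_iff₀ (by positivity)] at hH
    nlinarith
  have h8 : ‖(H : ℝ) • cesaroMean z N‖ < H * ε := by
    have := norm_sub_norm_le ((H : ℝ) • cesaroMean z N)
      (cesaroMean (fun n => ∑ h ∈ Finset.range H, z (n + h)) N)
    rw [norm_sub_rev] at this
    linarith
  rw [norm_smul, Real.norm_natCast] at h8
  exact lt_of_mul_lt_mul_left h8 hH0.le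

/-! ### Exponential sums with slowly decaying increments -/

/-- The character `e(x) = exp(2πix)` of the real line, with values in `ℂ`. -/
noncomputable def expChar (x : ℝ) : ℂ := Complex.exp ((2 * Real.pi * x : ℝ) * Complex.I)

theorem norm_expChar (x : ℝ) : ‖expChar x‖ = 1 := Complex.norm_exp_ofReal_mul_I _

theorem expChar_add (x y : ℝ) : expChar (x + y) = expChar x * expChar y := by
  simp only [expChar, ← Complex.exp_add]
  congr 1
  push_cast
  ring

theorem expChar_neg (x : ℝ) : expChar (-x) = starRingEnd ℂ (expChar x) := by
  rw [expChar, expChar, ← Complex.exp_conj, map_mul, Complex.conj_ofReal, Complex.conj_I]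
  congr 1
  push_cast
  ring

theorem expChar_sub (x y : ℝ) : expChar (x - y) = expChar x * starRingEnd ℂ (expChar y) := by
  rw [sub_eq_add_neg, expChar_add, expChar_neg]

theorem continuous_expChar : Continuous expChar := by
  unfold expChar
  fun_prop

theorem expChar_zero : expChar 0 = 1 := by simp [expChar]

theorem norm_exp_mul_I_sub_one_sub_le (x : ℝ) :
    ‖Complex.exp (x * Complex.I) - 1 - x * Complex.I‖ ≤ 3 * x ^ 2 := by
  have hn : ‖(x : ℂ) * Complex.I‖ = |x| := by simp
  rcases le_total |x| 1 with h | h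
  · have := Complex.norm_exp_sub_one_sub_id_le (x := x * Complex.I) (by rwa [hn])
    rw [hn, sq_abs] at this
    nlinarith [sq_nonneg x]
  · calc _ ≤ ‖Complex.exp (x * Complex.I)‖ + ‖(1 : ℂ)‖ + ‖(x : ℂ) * Complex.I‖ :=
          (norm_sub_le _ _).trans (add_le_add_left (norm_sub_le _ _) _)
      _ = 2 + |x| := by rw [Complex.norm_exp_ofReal_mul_I, hn, norm_one]; ring
      _ ≤ 3 * x ^ 2 := by rw [← sq_abs x]; nlinarith

theorem norm_expChar_sub_one_sub_le (x : ℝ) :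
    ‖expChar x - 1 - (2 * Real.pi * x : ℝ) * Complex.I‖ ≤ 12 * Real.pi ^ 2 * x ^ 2 := by
  calc _ ≤ 3 * (2 * Real.pi * x) ^ 2 := norm_exp_mul_I_sub_one_sub_le _
    _ = _ := by ring

/-- A positive sequence `b` which is, up to a constant, controlled (together with its increments) by
a sequence `u` decreasing to `0` more slowly than `1 / n`. -/
def IsSlowDecay (b : ℕ → ℝ) : Prop :=
  ∃ (u : ℕ → ℝ) (J : ℕ) (C : ℝ), Antitone u ∧ (∀ n, 0 < u n) ∧ Tendsto u atTop (𝓝 0) ∧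
    Tendsto (fun n : ℕ => n * u n) atTop atTop ∧ (∀ n, u n ≤ b n) ∧ (∀ n, b n ≤ C * u n) ∧
    ∀ n, |b (n + 1) - b n| ≤ C * (u n - u (n + J))

namespace IsSlowDecay

theorem pos {b : ℕ → ℝ} (hb : IsSlowDecay b) (n : ℕ) : 0 < b n := by
  obtain ⟨u, J, C, _, hpos, _, _, hub, _⟩ := hb
  exact (hpos n).trans_le (hub n)

theorem tendsto {b : ℕ → ℝ} (hb : IsSlowDecay b) : Tendsto b atTop (𝓝 0) := by
  have hb' := hb.pos
  obtain ⟨u, J, C, _, _, hu, _, _, hbu, _⟩ := hb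
  refine squeeze_zero (fun n => (hb' n).le) hbu ?_
  simpa using hu.const_mul C

/-- This stability is what van der Corput's induction needs. It is also why the increment bound
involves `u n - u (n + J)` with `J` free: summing `h` shifts enlarges the gap. -/
theorem sum_shift {b : ℕ → ℝ} (hb : IsSlowDecay b) {h : ℕ} (hh : 1 ≤ h) :
    IsSlowDecay fun n => ∑ i ∈ Finset.range h, b (n + i) := by
  have hb' := hb.pos
  obtain ⟨u, J, C, hanti, hpos, hu, hnu, hub, hbu, hd⟩ := hb
  have hC : 0 ≤ C := nonneg_of_mul_nonneg_left ((hb' 0).le.trans (hbu 0)) (hpos 0)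
  refine ⟨u, h + J, h * C, hanti, hpos, hu, hnu, fun n => ?_, fun n => ?_, fun n => ?_⟩
  · calc u n ≤ b (n + 0) := hub n
      _ ≤ _ := Finset.single_le_sum (f := fun i => b (n + i)) (fun i _ => (hb' _).le)
          (Finset.mem_range.2 hh)
  · calc ∑ i ∈ Finset.range h, b (n + i) ≤ ∑ i ∈ Finset.range h, C * u n :=
          Finset.sum_le_sum fun i _ => (hbu _).trans
            (mul_le_mul_of_nonneg_left (hanti (Nat.le_add_right _ _)) hC)
      _ = h * C * u n := by simp; ring
  · rw [← Finset.sum_sub_distrib]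
    calc _ ≤ ∑ i ∈ Finset.range h, |b (n + 1 + i) - b (n + i)| := Finset.abs_sum_le_sum_abs _ _
      _ ≤ ∑ i ∈ Finset.range h, C * (u n - u (n + (h + J))) := by
          refine Finset.sum_le_sum fun i hi => ?_
          have hi := Finset.mem_range.1 hi
          rw [add_right_comm]
          refine (hd _).trans (mul_le_mul_of_nonneg_left ?_ hC)
          exact sub_le_sub (hanti (by omega)) (hanti (by omega))
      _ = _ := by simp; ring

end IsSlowDecay

/-- Telescoping with gap `J` leaves only the last `J` terms minus the first `J`. -/
theorem sum_range_shift_sub_le {r : ℕ → ℝ} (hr : Monotone r) (h0 : ∀ n, 0 ≤ r n) (J N : ℕ) :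
    ∑ n ∈ Finset.range N, (r (n + J) - r n) ≤ J * r (N + J) := by
  have h1 := Finset.sum_range_add r N J
  have h2 := Finset.sum_range_add r J N
  rw [add_comm J N, h1] at h2
  simp only [add_comm _ J] at *
  rw [Finset.sum_sub_distrib]
  have h3 : ∑ n ∈ Finset.range J, r (N + n) ≤ ∑ n ∈ Finset.range J, r (J + N) :=
    Finset.sum_le_sum fun i hi => hr (by have := Finset.mem_range.1 hi; omega)
  have h4 : 0 ≤ ∑ n ∈ Finset.range J, r n := Finset.sum_nonneg fun i _ => h0 i
  simp only [Finset.sum_const, Finset.card_range, nsmul_eq_mul] at h3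
  linarith

/-- Fejér's theorem in difference form, with monotonicity of the differences weakened. -/
theorem tendsto_cesaroMean_expChar_of_fejer {a : ℕ → ℝ}
    (ha : IsSlowDecay fun n => a (n + 1) - a n) :
    Tendsto (cesaroMean fun n => expChar (a n)) atTop (𝓝 0) := by
  set b : ℕ → ℝ := fun n => a (n + 1) - a n with hb
  have hb0 := ha.tendsto
  have hbpos := ha.pos
  obtain ⟨u, J, C, hanti, hpos, hu, hnu, hub, hbu, hd⟩ := ha
  have hC : 0 ≤ C := nonneg_of_mul_nonneg_left ((hbpos 0).le.trans (hbu 0)) (hpos 0)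
  set z : ℕ → ℂ := fun n => expChar (a n) with hz
  have hz1 : ∀ n, ‖z n‖ = 1 := fun n => norm_expChar _
  have hb1 : ∀ n, (b n : ℂ) ≠ 0 := fun n => by exact_mod_cast (hbpos n).ne'
  have hrmono : Monotone fun n => (u n)⁻¹ := fun m n hmn => inv_anti₀ (hpos n) (hanti hmn)
  -- Up to an error `O(b n)`, whose mean vanishes, `z n` is proportional to `(z (n + 1) - z n) / b
  -- n`, which can be summed by parts.
  have hterm : ∀ n, ‖(2 * Real.pi * Complex.I) * z n - (z (n + 1) - z n) / b n‖
      ≤ 12 * Real.pi ^ 2 * b n := by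
    intro n
    have h1 : z (n + 1) = z n * expChar (b n) := by
      simp only [hz, hb, ← expChar_add]
      congr 1
      ring
    have h2 : (2 * Real.pi * Complex.I) * z n - (z (n + 1) - z n) / b n
        = -(z n * (expChar (b n) - 1 - (2 * Real.pi * b n : ℝ) * Complex.I) / b n) := by
      rw [h1]
      have := hb1 n
      field_simp
      push_cast
      ring
    rw [h2, norm_neg, norm_div, norm_mul, hz1, one_mul, Complex.norm_real, Real.norm_eq_abs,
      abs_of_pos (hbpos n), div_le_iff₀ (hbpos n)]
    calc _ ≤ 12 * Real.pi ^ 2 * b n ^ 2 := norm_expChar_sub_one_sub_le _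
      _ = _ := by ring
  have habel : ∀ N, ∑ n ∈ Finset.range N, (z (n + 1) - z n) / b n = z N / b N - z 0 / b 0
      + ∑ n ∈ Finset.range N, z (n + 1) * ((1 / b n : ℂ) - 1 / b (n + 1)) := by
    intro N
    rw [← Finset.sum_range_sub (fun n => z n / (b n : ℂ)), ← Finset.sum_add_distrib]
    refine Finset.sum_congr rfl fun n _ => ?_
    ring
  -- The gap is `J + 1` rather than `J` so that `u (n + (J + 1)) ≤ u (n + 1) ≤ b (n + 1)` holds even
  -- for `J = 0`.
  have hinc : ∀ n, ‖z (n + 1) * ((1 / b n : ℂ) - 1 / b (n + 1))‖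
      ≤ C * ((u (n + (J + 1)))⁻¹ - (u n)⁻¹) := by
    intro n
    have e1 : ((1 / b n : ℂ) - 1 / b (n + 1)) = ((b n)⁻¹ - (b (n + 1))⁻¹ : ℝ) := by
      push_cast; simp
    rw [norm_mul, hz1, one_mul, e1, Complex.norm_real, Real.norm_eq_abs,
      inv_sub_inv (hbpos _).ne' (hbpos _).ne', inv_sub_inv (hpos _).ne' (hpos _).ne', abs_div,
      abs_of_pos (mul_pos (hbpos n) (hbpos (n + 1))), ← mul_div_assoc]
    have h1 : u n - u (n + J) ≤ u n - u (n + (J + 1)) := sub_le_sub_left (hanti (by omega)) _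
    have h2 : 0 ≤ u n - u (n + (J + 1)) := sub_nonneg.2 (hanti (by omega))
    refine div_le_div₀ (by positivity)
      ((hd n).trans (mul_le_mul_of_nonneg_left h1 hC)) (mul_pos (hpos _) (hpos _)) ?_
    rw [mul_comm]
    exact mul_le_mul (hub n) ((hanti (by omega)).trans (hub (n + 1))) (hpos _).le (hbpos n).le
  have hbound : ∀ N, ‖(2 * Real.pi * Complex.I) * ∑ n ∈ Finset.range N, z n‖
      ≤ (2 + C * (J + 1)) * (u (N + (J + 1)))⁻¹ + 12 * Real.pi ^ 2 * ∑ n ∈ Finset.range N, b n := by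
    intro N
    have h1 : (2 * Real.pi * Complex.I) * ∑ n ∈ Finset.range N, z n
        = ∑ n ∈ Finset.range N, ((2 * Real.pi * Complex.I) * z n - (z (n + 1) - z n) / b n)
          + (z N / b N - z 0 / b 0
            + ∑ n ∈ Finset.range N, z (n + 1) * ((1 / b n : ℂ) - 1 / b (n + 1))) := by
      rw [← habel, Finset.sum_sub_distrib, Finset.mul_sum]
      ring
    have hdiv : ∀ n ≤ N, ‖z n / b n‖ ≤ (u (N + (J + 1)))⁻¹ := by
      intro n hn
      rw [norm_div, hz1, Complex.norm_real, Real.norm_eq_abs, abs_of_pos (hbpos n), one_div]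
      exact inv_anti₀ (hpos _) ((hanti (by omega)).trans (hub n))
    have h2 : ‖∑ n ∈ Finset.range N, z (n + 1) * ((1 / b n : ℂ) - 1 / b (n + 1))‖
        ≤ C * ((J + 1) * (u (N + (J + 1)))⁻¹) := by
      refine (norm_sum_le_of_le _ fun n _ => hinc n).trans ?_
      rw [← Finset.mul_sum]
      refine mul_le_mul_of_nonneg_left ?_ hC
      have := sum_range_shift_sub_le hrmono (fun n => (inv_pos.2 (hpos n)).le) (J + 1) N
      exact_mod_cast this
    have h3 : ‖∑ n ∈ Finset.range N, ((2 * Real.pi * Complex.I) * z n - (z (n + 1) - z n) / b n)‖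
        ≤ 12 * Real.pi ^ 2 * ∑ n ∈ Finset.range N, b n := by
      rw [Finset.mul_sum]
      exact norm_sum_le_of_le _ fun n _ => hterm n
    rw [h1]
    refine (norm_add_le _ _).trans ?_
    have h4 := norm_add_le (z N / b N - z 0 / b 0)
      (∑ n ∈ Finset.range N, z (n + 1) * ((1 / b n : ℂ) - 1 / b (n + 1)))
    have h5 := norm_sub_le (z N / (b N : ℂ)) (z 0 / b 0)
    have h6 := hdiv N le_rfl
    have h7 := hdiv 0 (Nat.zero_le _)
    linarith
  have hlim : Tendsto (fun N : ℕ => (2 * Real.pi)⁻¹ * ((2 + C * (J + 1)) *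
      ((N : ℝ)⁻¹ * (u (N + (J + 1)))⁻¹) + 12 * Real.pi ^ 2 * cesaroMean b N)) atTop (𝓝 0) := by
    -- The boundary terms and the variation of `1 / b` are both `O(1 / u (N + J + 1))`, and this is
    -- `o(N)` because `n * u n → ∞`.
    have h1 : Tendsto (fun N : ℕ => (N : ℝ)⁻¹ * (u (N + (J + 1)))⁻¹) atTop (𝓝 0) := by
      have h2 := (tendsto_add_atTop_iff_nat (J + 1)).2 hnu
      have h3 : Tendsto (fun N : ℕ => (N : ℝ) * u (N + (J + 1))) atTop atTop := by
        have h4 : Tendsto (fun N : ℕ => ((J + 1 : ℕ) : ℝ) * u (N + (J + 1))) atTop (𝓝 0) := by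
          simpa using ((tendsto_add_atTop_iff_nat (J + 1)).2 hu).const_mul ((J + 1 : ℕ) : ℝ)
        refine (h2.atTop_add h4.neg).congr fun N => ?_
        push_cast
        ring
      exact h3.inv_tendsto_atTop.congr fun N => mul_inv _ _
    simpa using ((h1.const_mul (2 + C * (J + 1))).add
      (hb0.cesaroMean.const_mul (12 * Real.pi ^ 2))).const_mul (2 * Real.pi)⁻¹
  refine squeeze_zero_norm (fun N => ?_) hlim
  have h1 := hbound N
  rw [norm_mul, norm_mul, norm_mul, Complex.norm_I, Complex.norm_real, Complex.norm_ofNat,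
    Real.norm_eq_abs, abs_of_pos Real.pi_pos, mul_one] at h1
  rw [cesaroMean, norm_smul, norm_inv, Real.norm_natCast, inv_mul_eq_div, inv_mul_eq_div,
    le_div_iff₀ (by positivity), div_mul_eq_mul_div, mul_comm _ (2 * Real.pi), div_eq_inv_mul]
  calc _ ≤ (N : ℝ)⁻¹ * ((2 + C * (J + 1)) * (u (N + (J + 1)))⁻¹
        + 12 * Real.pi ^ 2 * ∑ n ∈ Finset.range N, b n) := by gcongr
    _ = _ := by rw [cesaroMean, smul_eq_mul]; ring

/-! ### Reduction of higher differences to Fejér's theorem -/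

theorem fwdDiff_iter_sub_shift (a : ℕ → ℝ) (k h : ℕ) :
    (fwdDiff 1)^[k] (fun n => a (n + h) - a n)
      = fun n => ∑ i ∈ Finset.range h, (fwdDiff 1)^[k + 1] a (n + i) := by
  have h1 : (fun n => a (n + h) - a n) = ∑ i ∈ Finset.range h, fun n => fwdDiff 1 a (n + i) := by
    ext n
    rw [Finset.sum_apply]
    exact (Finset.sum_range_sub (fun i => a (n + i)) h).symm
  rw [h1, fwdDiff_iter_finsetSum]
  ext n
  rw [Finset.sum_apply]
  refine Finset.sum_congr rfl fun i _ => ?_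
  rw [fwdDiff_iter_comp_add, Function.iterate_succ_apply]

/-- Each van der Corput step replaces `a` by `a (n + h) - a n`, a sum of `h` shifts of `Δ a`, and so
lowers the order of the required difference by one. -/
theorem tendsto_cesaroMean_expChar_of_isSlowDecay {a : ℕ → ℝ} {k : ℕ}
    (ha : IsSlowDecay ((fwdDiff 1)^[k + 1] a)) :
    Tendsto (cesaroMean fun n => expChar (a n)) atTop (𝓝 0) := by
  induction k generalizing a with
  | zero => exact tendsto_cesaroMean_expChar_of_fejer ha
  | succ k ih =>
    refine tendsto_cesaroMean_of_vanDerCorput (fun n => norm_expChar _) fun h hh => ?_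
    simp only [← expChar_sub]
    refine ih (a := fun n => a (n + h) - a n) ?_
    rw [fwdDiff_iter_sub_shift]
    exact ha.sum_shift hh

/-! ### Polynomials in the shift and convex sequences -/

/-- The shift operator on real sequences. -/
def seqShift : Module.End ℝ (ℕ → ℝ) := LinearMap.funLeft ℝ ℝ fun n => n + 1

theorem seqShift_pow_apply (k : ℕ) (a : ℕ → ℝ) (n : ℕ) : (seqShift ^ k) a n = a (n + k) := by
  induction k generalizing n with
  | zero => simp
  | succ k ih =>
    rw [pow_succ', Module.End.mul_apply]
    change (seqShift ^ k) a (n + 1) = _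
    rw [ih, add_right_comm, add_assoc]

section Shift

open Polynomial

theorem aeval_seqShift_apply (P : ℝ[X]) (a : ℕ → ℝ) (n : ℕ) :
    aeval seqShift P a n = ∑ j ∈ Finset.range (P.natDegree + 1), P.coeff j * a (n + j) := by
  rw [aeval_eq_sum_range]
  simp [LinearMap.sum_apply, seqShift_pow_apply]

theorem aeval_seqShift_mul (P Q : ℝ[X]) (a : ℕ → ℝ) :
    aeval seqShift (P * Q) a = aeval seqShift P (aeval seqShift Q a) := by
  rw [map_mul, Module.End.mul_apply]

theorem aeval_seqShift_X_sub_one_pow (k : ℕ) (a : ℕ → ℝ) :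
    aeval seqShift ((X - 1 : ℝ[X]) ^ k) a = (fwdDiff 1)^[k] a := by
  induction k generalizing a with
  | zero => simp
  | succ k ih =>
    rw [pow_succ, aeval_seqShift_mul, ih, Function.iterate_succ_apply]
    congr 1
    ext n
    simp [fwdDiff, seqShift, LinearMap.funLeft_apply]

theorem tendsto_aeval_seqShift (P : ℝ[X]) {a : ℕ → ℝ} (ha : Tendsto a atTop (𝓝 0)) :
    Tendsto (aeval seqShift P a) atTop (𝓝 0) := by
  have : aeval seqShift P a
      = fun n => ∑ j ∈ Finset.range (P.natDegree + 1), P.coeff j * a (n + j) :=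
    funext (aeval_seqShift_apply P a)
  rw [this]
  have := tendsto_finsetSum (Finset.range (P.natDegree + 1)) fun j _ =>
    ((tendsto_add_atTop_iff_nat j).2 ha).const_mul (P.coeff j)
  simpa using this

/-- A positive convex sequence decreasing to `0` more slowly than `1 / n`. -/
structure IsConvexDecay (u : ℕ → ℝ) : Prop where
  antitone : Antitone u
  convex : Antitone fun n => u n - u (n + 1)
  pos : ∀ n, 0 < u n
  tendsto : Tendsto u atTop (𝓝 0)
  tendsto_mul : Tendsto (fun n : ℕ => n * u n) atTop atTop

namespace IsConvexDecay

/-- Convexity gives `n * (u n - u (n + 1)) ≤ u 0` by telescoping, so differences over a fixed gap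
are `O(1 / n)`, which is `o(u n)`. -/
theorem eventually_sub_le {u : ℕ → ℝ} (hu : IsConvexDecay u) (J : ℕ) {ε : ℝ} (hε : 0 < ε) :
    ∀ᶠ n in atTop, u n - u (n + J) ≤ ε * u n := by
  have h1 : ∀ n : ℕ, n * (u n - u (n + 1)) ≤ u 0 := by
    intro n
    have h2 : ∑ i ∈ Finset.range n, (u n - u (n + 1)) ≤ ∑ i ∈ Finset.range n, (u i - u (i + 1)) :=
      Finset.sum_le_sum fun i hi => hu.convex (Finset.mem_range.1 hi).le
    rw [Finset.sum_range_sub'] at h2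
    simp only [Finset.sum_const, Finset.card_range, nsmul_eq_mul] at h2
    linarith [hu.pos n]
  have h2 : ∀ n : ℕ, u n - u (n + J) ≤ J * (u n - u (n + 1)) := by
    intro n
    have h3 : ∑ i ∈ Finset.range J, (u (n + i) - u (n + (i + 1)))
        ≤ ∑ i ∈ Finset.range J, (u n - u (n + 1)) :=
      Finset.sum_le_sum fun i _ => hu.convex (Nat.le_add_right n i)
    rw [Finset.sum_range_sub' (fun i => u (n + i))] at h3
    simpa only [add_zero, Finset.sum_const, Finset.card_range, nsmul_eq_mul] using h3
  filter_upwards [hu.tendsto_mul.eventually_ge_atTop (J * u 0 / ε), eventually_gt_atTop 0]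
    with n hn hn0
  have hn0' : (0 : ℝ) < n := by exact_mod_cast hn0
  rw [div_le_iff₀ hε] at hn
  refine (h2 n).trans (le_of_mul_le_mul_left ?_ hn0')
  calc (n : ℝ) * (J * (u n - u (n + 1))) = J * (n * (u n - u (n + 1))) := by ring
    _ ≤ J * u 0 := mul_le_mul_of_nonneg_left (h1 n) (Nat.cast_nonneg _)
    _ ≤ n * (ε * u n) := by linarith

/-- `Q(S) u` differs from `Q(1) u` by a combination of differences of `u` over bounded gaps, and
these are `o(u)`. -/
theorem exists_isSlowDecay_aeval {u : ℕ → ℝ} (hu : IsConvexDecay u) {Q : ℝ[X]}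
    (hQ : 0 < Q.eval 1) : ∃ M : ℕ, IsSlowDecay fun n => aeval seqShift Q u (n + M) := by
  set D := Q.eval 1 with hD
  set A := ∑ j ∈ Finset.range (Q.natDegree + 1), |Q.coeff j| with hA
  have hA0 : 0 ≤ A := Finset.sum_nonneg fun _ _ => abs_nonneg _
  have hDsum : D = ∑ j ∈ Finset.range (Q.natDegree + 1), Q.coeff j := by
    rw [hD, eval_eq_sum_range]
    simp
  have hbase : ∀ n, |aeval seqShift Q u n - D * u n| ≤ A * (u n - u (n + (Q.natDegree + 1))) := by
    intro n
    rw [aeval_seqShift_apply, hDsum, Finset.sum_mul, ← Finset.sum_sub_distrib, hA, Finset.sum_mul]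
    refine (Finset.abs_sum_le_sum_abs _ _).trans (Finset.sum_le_sum fun j hj => ?_)
    have hj := Finset.mem_range.1 hj
    rw [← mul_sub, abs_mul, abs_sub_comm,
      abs_of_nonneg (sub_nonneg.2 (hu.antitone (Nat.le_add_right n j)))]
    exact mul_le_mul_of_nonneg_left (sub_le_sub_left (hu.antitone (by omega)) _) (abs_nonneg _)
  have hdiff : ∀ n, |aeval seqShift Q u (n + 1) - aeval seqShift Q u n|
      ≤ A * (u n - u (n + (Q.natDegree + 1))) := by
    intro n
    rw [aeval_seqShift_apply, aeval_seqShift_apply, ← Finset.sum_sub_distrib, hA, Finset.sum_mul]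
    refine (Finset.abs_sum_le_sum_abs _ _).trans (Finset.sum_le_sum fun j hj => ?_)
    have hj := Finset.mem_range.1 hj
    rw [← mul_sub, abs_mul, abs_sub_comm, abs_of_nonneg (sub_nonneg.2 (hu.antitone (by omega)))]
    exact mul_le_mul_of_nonneg_left
      (sub_le_sub (hu.antitone (by omega)) (hu.antitone (by omega))) (abs_nonneg _)
  obtain ⟨M, hM⟩ := eventually_atTop.1
    (hu.eventually_sub_le (Q.natDegree + 1) (show 0 < D / (2 * (A + 1)) by positivity))
  have hclose : ∀ n, |aeval seqShift Q u (n + M) - D * u (n + M)| ≤ D / 2 * u (n + M) := by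
    intro n
    refine (hbase _).trans ?_
    calc _ ≤ (A + 1) * (u (n + M) - u (n + M + (Q.natDegree + 1))) :=
          mul_le_mul_of_nonneg_right (by linarith) (sub_nonneg.2 (hu.antitone (by omega)))
      _ ≤ (A + 1) * (D / (2 * (A + 1)) * u (n + M)) :=
          mul_le_mul_of_nonneg_left (hM _ (by omega)) (by linarith)
      _ = _ := by field_simp
  -- `Q(S) u` lies between one and three times `D / 2 * u` beyond `M`; the summand `2 * A / D` of
  -- the constant serves the increments.
  refine ⟨M, fun n => D / 2 * u (n + M), Q.natDegree + 1, 3 + 2 * A / D, ?_, ?_, ?_, ?_, ?_, ?_, ?_⟩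
  · intro m n hmn
    exact mul_le_mul_of_nonneg_left (hu.antitone (by omega)) (by positivity)
  · intro n
    have := hu.pos (n + M)
    positivity
  · simpa using ((tendsto_add_atTop_iff_nat M).2 hu.tendsto).const_mul (D / 2)
  · have h1 := (tendsto_add_atTop_iff_nat M).2 hu.tendsto_mul
    have h2 := ((tendsto_add_atTop_iff_nat M).2 hu.tendsto).const_mul (M : ℝ)
    refine ((h1.atTop_add h2.neg).const_mul_atTop (show 0 < D / 2 by positivity)).congr fun n => ?_
    push_cast
    ring
  · intro n
    linarith [(abs_le.1 (hclose n)).1]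
  · intro n
    have h1 := (abs_le.1 (hclose n)).2
    have h2 : 0 ≤ 2 * A / D * (D / 2 * u (n + M)) := by
      have := hu.pos (n + M)
      positivity
    linarith
  · intro n
    have h1 := hdiff (n + M)
    have h2 : 0 ≤ u (n + M) - u (n + M + (Q.natDegree + 1)) := sub_nonneg.2 (hu.antitone (by omega))
    rw [add_right_comm n M, add_right_comm n M] at h1
    rw [add_right_comm n M] at h2
    refine h1.trans ?_
    simp only
    rw [← mul_sub, add_mul]
    have h3 : 2 * A / D * (D / 2 * (u (n + M) - u (n + (Q.natDegree + 1) + M)))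
        = A * (u (n + M) - u (n + (Q.natDegree + 1) + M)) := by
      field_simp
    have h4 : 0 ≤ D / 2 * (u (n + M) - u (n + (Q.natDegree + 1) + M)) := by positivity
    linarith

variable {a : ℕ → ℝ} {m : ℕ}

theorem tendsto_cesaroMean_expChar_pow_mul (ha : IsConvexDecay ((fwdDiff 1)^[m] a)) {i : ℕ}
    (hi : i < m) {Q : ℝ[X]} (hQ : Q.eval 1 ≠ 0) :
    Tendsto (cesaroMean fun n => expChar (aeval seqShift ((X - 1) ^ i * Q) a n)) atTop (𝓝 0) := by
  -- Replacing `Q` by `-Q` conjugates the sum.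
  wlog hpos : 0 < Q.eval 1 generalizing Q
  · have h1 := this (Q := -Q) (by simpa using hQ) (by
      rw [eval_neg]; exact neg_pos.2 (lt_of_le_of_ne (not_lt.1 hpos) hQ))
    have h2 := (Complex.continuous_conj.tendsto _).comp h1
    rw [map_zero] at h2
    refine h2.congr fun N => ?_
    simp [cesaroMean, expChar_neg]
  obtain ⟨M, hM⟩ := ha.exists_isSlowDecay_aeval hpos
  obtain ⟨k, rfl⟩ := Nat.exists_eq_add_of_lt hi
  have h1 : (fwdDiff 1)^[k + 1] (aeval seqShift ((X - 1) ^ i * Q) a)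
      = aeval seqShift Q ((fwdDiff 1)^[i + k + 1] a) := by
    rw [← aeval_seqShift_X_sub_one_pow, ← aeval_seqShift_X_sub_one_pow, ← aeval_seqShift_mul,
      ← aeval_seqShift_mul]
    congr 2
    ring
  refine (tendsto_cesaroMean_shift_iff (C := 1) (fun n => (norm_expChar _).le) M 0).1 ?_
  refine tendsto_cesaroMean_expChar_of_isSlowDecay (k := k)
    (a := fun n => aeval seqShift ((X - 1) ^ i * Q) a (n + M)) ?_
  have h2 : (fwdDiff 1)^[k + 1] (fun n => aeval seqShift ((X - 1) ^ i * Q) a (n + M))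
      = fun n => aeval seqShift Q ((fwdDiff 1)^[i + k + 1] a) (n + M) := by
    ext n
    rw [fwdDiff_iter_comp_add, h1]
  rwa [h2]

theorem tendsto_cesaroMean_expChar_of_eval_ne_zero (ha : IsConvexDecay ((fwdDiff 1)^[m] a))
    (hm : 0 < m) {P : ℝ[X]} (hP : P.eval 1 ≠ 0) :
    Tendsto (cesaroMean fun n => expChar (aeval seqShift P a n)) atTop (𝓝 0) := by
  simpa using ha.tendsto_cesaroMean_expChar_pow_mul hm hP

/-- The order of vanishing of `P` at `1` decides: below `m` there is cancellation, from `m` on the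
phase itself tends to `0`. -/
theorem exists_tendsto_cesaroMean_expChar (ha : IsConvexDecay ((fwdDiff 1)^[m] a)) (P : ℝ[X]) :
    ∃ L, Tendsto (cesaroMean fun n => expChar (aeval seqShift P a n)) atTop (𝓝 L) := by
  rcases eq_or_ne P 0 with rfl | hP
  · exact ⟨1, Tendsto.cesaroMean (by simp [expChar_zero])⟩
  obtain ⟨Q, hPQ, hQ⟩ := P.exists_eq_pow_rootMultiplicity_mul_and_not_dvd hP 1
  rw [C_1] at hPQ
  rw [dvd_iff_isRoot] at hQ
  set i := P.rootMultiplicity 1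
  rcases lt_or_ge i m with hi | hi
  · exact ⟨0, by rw [hPQ]; exact ha.tendsto_cesaroMean_expChar_pow_mul hi hQ⟩
  · obtain ⟨k, hk⟩ := Nat.exists_eq_add_of_le' hi
    have h1 : aeval seqShift P a
        = aeval seqShift (Q * (X - 1) ^ k) ((fwdDiff 1)^[m] a) := by
      rw [← aeval_seqShift_X_sub_one_pow, ← aeval_seqShift_mul, hPQ, hk]
      congr 2
      ring
    refine ⟨expChar 0, Tendsto.cesaroMean ?_⟩
    rw [h1]
    exact (continuous_expChar.tendsto 0).comp (tendsto_aeval_seqShift _ ha.tendsto)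

end IsConvexDecay

end Shift

/-! ### Integrating asymptotic inequalities -/

theorem exists_monotoneOn_Ici_of_deriv_nonneg {F f : ℝ → ℝ}
    (hF : ∀ᶠ t in atTop, HasDerivAt F (f t) t) (hf : ∀ᶠ t in atTop, 0 ≤ f t) :
    ∃ T, MonotoneOn F (Set.Ici T) := by
  obtain ⟨T, hT⟩ := eventually_atTop.1 (hF.and hf)
  refine ⟨T, monotoneOn_of_deriv_nonneg (convex_Ici T)
    (fun t ht => (hT t ht).1.continuousAt.continuousWithinAt) (fun t ht => ?_) fun t ht => ?_⟩
  · exact (hT t (interior_subset ht)).1.differentiableAt.differentiableWithinAt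
  · rw [(hT t (interior_subset ht)).1.deriv]
    exact (hT t (interior_subset ht)).2

theorem exists_le_add_of_deriv_le {F f G g : ℝ → ℝ} (hF : ∀ᶠ t in atTop, HasDerivAt F (f t) t)
    (hG : ∀ᶠ t in atTop, HasDerivAt G (g t) t) (hfg : ∀ᶠ t in atTop, f t ≤ g t) :
    ∃ K, ∀ᶠ t in atTop, F t ≤ G t + K := by
  obtain ⟨T, hT⟩ := exists_monotoneOn_Ici_of_deriv_nonneg (F := fun t => G t - F t)
    (f := fun t => g t - f t) (by filter_upwards [hF, hG] with t h1 h2 using h2.sub h1)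
    (by filter_upwards [hfg] with t ht using sub_nonneg.2 ht)
  refine ⟨F T - G T, ?_⟩
  filter_upwards [eventually_ge_atTop T] with t ht
  have := hT Set.self_mem_Ici ht ht
  simp only at this
  linarith

/-- The factor `2` absorbs the constant of integration, since `G → ∞`. -/
theorem eventually_le_two_mul_of_deriv_le {F f G g : ℝ → ℝ}
    (hF : ∀ᶠ t in atTop, HasDerivAt F (f t) t) (hG : ∀ᶠ t in atTop, HasDerivAt G (g t) t)
    (hfg : ∀ᶠ t in atTop, f t ≤ g t) (hGtop : Tendsto G atTop atTop) :
    ∀ᶠ t in atTop, F t ≤ 2 * G t := by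
  obtain ⟨K, hK⟩ := exists_le_add_of_deriv_le hF hG hfg
  filter_upwards [hK, hGtop.eventually_ge_atTop K] with t h1 h2
  linarith

theorem eventually_half_le_of_le_deriv {F f G g : ℝ → ℝ}
    (hF : ∀ᶠ t in atTop, HasDerivAt F (f t) t) (hG : ∀ᶠ t in atTop, HasDerivAt G (g t) t)
    (hfg : ∀ᶠ t in atTop, g t ≤ f t) (hGtop : Tendsto G atTop atTop) :
    ∀ᶠ t in atTop, G t / 2 ≤ F t := by
  obtain ⟨K, hK⟩ := exists_le_add_of_deriv_le hG hF hfg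
  filter_upwards [hK, hGtop.eventually_ge_atTop (2 * K)] with t h1 h2
  linarith

theorem exists_mul_pow_le_of_mul_pow_le_deriv {F f : ℝ → ℝ} {k : ℕ}
    (hF : ∀ᶠ t in atTop, HasDerivAt F (f t) t) (h : ∃ c > 0, ∀ᶠ t in atTop, c * t ^ k ≤ f t) :
    ∃ c > 0, ∀ᶠ t in atTop, c * t ^ (k + 1) ≤ F t := by
  obtain ⟨c, hc, h⟩ := h
  have hG : ∀ t : ℝ, HasDerivAt (fun t => c / (k + 1) * t ^ (k + 1)) (c * t ^ k) t := by
    intro t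
    refine ((hasDerivAt_pow (k + 1) t).const_mul (c / (k + 1))).congr_deriv ?_
    have hk : (k + 1 : ℝ) ≠ 0 := by positivity
    rw [Nat.add_sub_cancel, ← mul_assoc, Nat.cast_add_one, div_mul_cancel₀ _ hk]
  refine ⟨c / (k + 1) / 2, by positivity, ?_⟩
  have := eventually_half_le_of_le_deriv hF (Eventually.of_forall hG) h
    ((tendsto_pow_atTop (Nat.succ_ne_zero k)).const_mul_atTop (by positivity))
  filter_upwards [this] with t ht
  linarith

theorem tendsto_pow_mul_log_atTop (k : ℕ) :
    Tendsto (fun t : ℝ => t ^ k * Real.log t) atTop atTop := by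
  rcases Nat.eq_zero_or_pos k with rfl | hk
  · simpa using Real.tendsto_log_atTop
  · exact (tendsto_pow_atTop hk.ne').atTop_mul_atTop₀ Real.tendsto_log_atTop

theorem exists_abs_le_pow_mul_log_of_deriv {F f : ℝ → ℝ} {k : ℕ}
    (hF : ∀ᶠ t in atTop, HasDerivAt F (f t) t)
    (h : ∃ C > 0, ∀ᶠ t in atTop, |f t| ≤ C * (t ^ k * Real.log t)) :
    ∃ C > 0, ∀ᶠ t in atTop, |F t| ≤ C * (t ^ (k + 1) * Real.log t) := by
  obtain ⟨C, hC, h⟩ := h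
  -- The majorant `t ^ (k + 1) * log t` needs no exact integration: its derivative already dominates
  -- `t ^ k * log t`.
  have hG : ∀ᶠ t : ℝ in atTop, HasDerivAt (fun t => C * (t ^ (k + 1) * Real.log t))
      (C * ((k + 1 : ℕ) * t ^ k * Real.log t + t ^ (k + 1) * t⁻¹)) t := by
    filter_upwards [eventually_gt_atTop 0] with t ht
    exact ((hasDerivAt_pow (k + 1) t).mul (Real.hasDerivAt_log ht.ne')).const_mul C
  have hle : ∀ᶠ t : ℝ in atTop, |f t|
      ≤ C * ((k + 1 : ℕ) * t ^ k * Real.log t + t ^ (k + 1) * t⁻¹) := by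
    filter_upwards [h, eventually_ge_atTop 1] with t ht ht1
    refine ht.trans (mul_le_mul_of_nonneg_left ?_ hC.le)
    have h1 : 0 ≤ t ^ k * Real.log t := mul_nonneg (by positivity) (Real.log_nonneg ht1)
    have h2 : 0 ≤ t ^ (k + 1) * t⁻¹ := by positivity
    have h3 : 0 ≤ (k : ℝ) * (t ^ k * Real.log t) := by positivity
    push_cast
    linarith
  have htop := (tendsto_pow_mul_log_atTop (k + 1)).const_mul_atTop hC
  refine ⟨2 * C, by positivity, ?_⟩
  filter_upwards [eventually_le_two_mul_of_deriv_le hF hG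
    (hle.mono fun t ht => (le_abs_self _).trans ht) htop,
    eventually_le_two_mul_of_deriv_le (hF.mono fun t ht => ht.neg) hG
    (hle.mono fun t ht => (neg_le_abs _).trans ht) htop] with t h1 h2
  rw [abs_le]
  rw [Pi.neg_apply] at h2
  constructor <;> linarith

theorem exists_abs_le_log_of_deriv {F f : ℝ → ℝ} (hF : ∀ᶠ t in atTop, HasDerivAt F (f t) t)
    (h : ∃ C > 0, ∀ᶠ t in atTop, |f t| ≤ C * t⁻¹) :
    ∃ C > 0, ∀ᶠ t in atTop, |F t| ≤ C * (t ^ 0 * Real.log t) := by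
  obtain ⟨C, hC, h⟩ := h
  have hG : ∀ᶠ t : ℝ in atTop, HasDerivAt (fun t => C * Real.log t) (C * t⁻¹) t := by
    filter_upwards [eventually_gt_atTop 0] with t ht
    exact (Real.hasDerivAt_log ht.ne').const_mul C
  have htop := Real.tendsto_log_atTop.const_mul_atTop hC
  refine ⟨2 * C, by positivity, ?_⟩
  filter_upwards [eventually_le_two_mul_of_deriv_le hF hG
    (h.mono fun t ht => (le_abs_self _).trans ht) htop,
    eventually_le_two_mul_of_deriv_le (hF.mono fun t ht => ht.neg) hG
    (h.mono fun t ht => (neg_le_abs _).trans ht) htop] with t h1 h2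
  rw [abs_le, pow_zero, one_mul]
  rw [Pi.neg_apply] at h2
  constructor <;> linarith

/-- `f 1, f 2, …` are the successive derivatives of `f 0` near `+∞`. -/
def IsDerivChain (f : ℕ → ℝ → ℝ) : Prop :=
  ∀ i, ∀ᶠ t in atTop, HasDerivAt (f i) (f (i + 1) t) t

namespace IsDerivChain

variable {f : ℕ → ℝ → ℝ}

theorem neg (hf : IsDerivChain f) : IsDerivChain fun i => -f i :=
  fun i => (hf i).mono fun _ ht => ht.neg

theorem exists_mul_pow_le (hf : IsDerivChain f) {m k : ℕ}
    (h : ∃ c > 0, ∀ᶠ t in atTop, c * t ^ k ≤ f m t) :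
    ∃ c > 0, ∀ᶠ t in atTop, c * t ^ (k + m) ≤ f 0 t := by
  induction m generalizing k with
  | zero => exact h
  | succ m ih =>
    have := ih (exists_mul_pow_le_of_mul_pow_le_deriv (hf m) h)
    rwa [show k + 1 + m = k + (m + 1) by ring] at this

theorem exists_abs_le_pow_mul_log (hf : IsDerivChain f) {m k : ℕ}
    (h : ∃ C > 0, ∀ᶠ t in atTop, |f m t| ≤ C * (t ^ k * Real.log t)) :
    ∃ C > 0, ∀ᶠ t in atTop, |f 0 t| ≤ C * (t ^ (k + m) * Real.log t) := by
  induction m generalizing k with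
  | zero => exact h
  | succ m ih =>
    have := ih (exists_abs_le_pow_mul_log_of_deriv (hf m) h)
    rwa [show k + 1 + m = k + (m + 1) by ring] at this

end IsDerivChain

/-! ### Rigidity of Hardy field elements -/

namespace IsHardyField

variable {H : Subring (Germ (atTop : Filter ℝ) ℝ)}

theorem exists_inv (hH : IsHardyField H) {f : ℝ → ℝ} (hf : (f : Germ atTop ℝ) ∈ H)
    (h0 : ¬ f =ᶠ[atTop] 0) : ∃ p : ℝ → ℝ, (p : Germ atTop ℝ) ∈ H ∧ ∀ᶠ t in atTop, f t * p t = 1 := by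
  have hne : (⟨(f : Germ atTop ℝ), hf⟩ : H) ≠ 0 := by
    intro h
    exact h0 (Germ.coe_eq.1 (congrArg Subtype.val h))
  obtain ⟨⟨φ, hφ⟩, h⟩ := hH.isField.mul_inv_cancel hne
  induction φ using Germ.inductionOn with
  | h p => exact ⟨p, hφ, Germ.coe_eq.1 (congrArg Subtype.val h)⟩

/-- A nonzero element is invertible, so it has no zeros near infinity; by continuity it cannot
change sign there. -/
theorem eventually_sign (hH : IsHardyField H) {f : ℝ → ℝ} (hf : (f : Germ atTop ℝ) ∈ H) :
    f =ᶠ[atTop] 0 ∨ (∀ᶠ t in atTop, 0 < f t) ∨ ∀ᶠ t in atTop, f t < 0 := by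
  by_cases h0 : f =ᶠ[atTop] 0
  · exact Or.inl h0
  obtain ⟨p, -, hp⟩ := hH.exists_inv hf h0
  obtain ⟨f₁, t₀, hcont, heq⟩ := hH.le_continuousGerms hf
  obtain ⟨T, hT⟩ := eventually_atTop.1
    ((hp.and (Germ.coe_eq.1 heq)).and (eventually_ge_atTop t₀))
  have hcont' : ContinuousOn f (Set.Ici T) :=
    (hcont.mono fun t ht => (hT t ht).2).congr fun t ht => (hT t ht).1.2
  have hne : ∀ t ≥ T, f t ≠ 0 := fun t ht h => by
    have := (hT t ht).1.1
    rw [h, zero_mul] at this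
    exact zero_ne_one this
  right
  rcases lt_or_gt_of_ne (hne T le_rfl) with h | h
  · right
    filter_upwards [eventually_ge_atTop T] with t ht
    by_contra! hft
    obtain ⟨s, hs, hs0⟩ := intermediate_value_Icc ht
      (hcont'.mono Set.Icc_subset_Ici_self) (Set.mem_Icc.2 ⟨h.le, hft⟩)
    exact hne s hs.1 hs0
  · left
    filter_upwards [eventually_ge_atTop T] with t ht
    by_contra! hft
    obtain ⟨s, hs, hs0⟩ := intermediate_value_Icc' ht
      (hcont'.mono Set.Icc_subset_Ici_self) (Set.mem_Icc.2 ⟨hft, h.le⟩)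
    exact hne s hs.1 hs0

theorem exists_deriv (hH : IsHardyField H) {f : ℝ → ℝ} (hf : (f : Germ atTop ℝ) ∈ H) :
    ∃ f' : ℝ → ℝ, (f' : Germ atTop ℝ) ∈ H ∧ ∀ᶠ t in atTop, HasDerivAt f (f' t) t := by
  obtain ⟨ψ, hψ, f₁, f', h1, rfl, hd⟩ := hH.deriv_mem _ hf
  refine ⟨f', hψ, ?_⟩
  obtain ⟨T, hT⟩ := eventually_atTop.1 (hd.and (Germ.coe_eq.1 h1))
  filter_upwards [eventually_gt_atTop T] with t ht
  refine (hT t ht.le).1.congr_of_eventuallyEq ?_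
  filter_upwards [Ioi_mem_nhds ht] with s hs using (hT s (le_of_lt hs)).2

theorem exists_isDerivChain (hH : IsHardyField H) {g : ℝ → ℝ} (hg : (g : Germ atTop ℝ) ∈ H) :
    ∃ f : ℕ → ℝ → ℝ, f 0 = g ∧ (∀ i, (f i : Germ atTop ℝ) ∈ H) ∧ IsDerivChain f := by
  choose D hDmem hD using fun f : {f : ℝ → ℝ // (f : Germ atTop ℝ) ∈ H} => hH.exists_deriv f.2
  let F : ℕ → {f : ℝ → ℝ // (f : Germ atTop ℝ) ∈ H} :=
    fun n => Nat.rec ⟨g, hg⟩ (fun _ f => ⟨D f, hDmem f⟩) n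
  exact ⟨fun n => (F n).1, rfl, fun i => (F i).2, fun i => hD (F i)⟩

/-- A Hardy field need not contain all real constants, so `f` is compared with `1 / k` through the
sign of `k * f - 1`. -/
theorem eventually_lt_of_not_le (hH : IsHardyField H) {f : ℝ → ℝ} (hf : (f : Germ atTop ℝ) ∈ H)
    (h : ∀ c > 0, ¬ ∀ᶠ t in atTop, c ≤ f t) {c : ℝ} (hc : 0 < c) : ∀ᶠ t in atTop, f t < c := by
  obtain ⟨k, hk⟩ := exists_nat_gt c⁻¹
  have hk0 : (0 : ℝ) < k := (inv_pos.2 hc).trans hk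
  have hkc : (k : ℝ)⁻¹ < c := inv_lt_of_inv_lt₀ hc hk
  have hmem : ((fun t => k * f t - 1 : ℝ → ℝ) : Germ atTop ℝ) ∈ H :=
    sub_mem (mul_mem (natCast_mem H k) hf) (one_mem H)
  rcases hH.eventually_sign hmem with h1 | h1 | h1
  · filter_upwards [h1] with t ht
    refine lt_of_eq_of_lt ?_ hkc
    exact eq_inv_of_mul_eq_one_right (sub_eq_zero.1 ht)
  · refine absurd ?_ (h (k : ℝ)⁻¹ (inv_pos.2 hk0))
    filter_upwards [h1] with t ht
    rw [inv_le_iff_one_le_mul₀' hk0]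
    linarith
  · filter_upwards [h1] with t ht
    refine lt_trans ?_ hkc
    rw [← one_div, lt_div_iff₀' hk0]
    linarith

theorem tendsto_zero (hH : IsHardyField H) {f : ℝ → ℝ} (hf : (f : Germ atTop ℝ) ∈ H)
    (h : ∀ c > 0, ¬ ∀ᶠ t in atTop, c ≤ f t) (h' : ∀ c > 0, ¬ ∀ᶠ t in atTop, c ≤ -f t) :
    Tendsto f atTop (𝓝 0) := by
  rw [Metric.tendsto_nhds]
  intro ε hε
  filter_upwards [hH.eventually_lt_of_not_le hf h hε,
    hH.eventually_lt_of_not_le (f := -f) (neg_mem hf) h' hε] with t h1 h2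
  rw [Real.dist_eq, sub_zero, abs_lt]
  rw [Pi.neg_apply] at h2
  constructor <;> linarith

/-- An element of a Hardy field which is not `O(1/t)` is of larger order than `1/t`. -/
theorem tendsto_mul_abs_atTop (hH : IsHardyField H) {w : ℝ → ℝ} (hw : (w : Germ atTop ℝ) ∈ H)
    (h : ¬ ∃ C > 0, ∀ᶠ t in atTop, |w t| ≤ C * t⁻¹) :
    Tendsto (fun t => t * |w t|) atTop atTop := by
  have h0 : ¬ w =ᶠ[atTop] 0 := fun h0 => h ⟨1, one_pos, by
    filter_upwards [h0, eventually_gt_atTop 0] with t ht ht0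
    rw [ht, Pi.zero_apply, abs_zero]
    positivity⟩
  obtain ⟨p, hp, hwp⟩ := hH.exists_inv hw h0
  obtain ⟨p', hp', hd⟩ := hH.exists_deriv hp
  have hsmall : ∀ c > 0, ¬ ∀ᶠ t in atTop, c * t ≤ |p t| := by
    intro c hc hcp
    refine h ⟨c⁻¹, by positivity, ?_⟩
    filter_upwards [hcp, hwp, eventually_gt_atTop 0] with t h1 h2 ht
    have h3 : |w t| * |p t| = 1 := by rw [← abs_mul, h2, abs_one]
    rw [← mul_inv, ← one_div, le_div_iff₀ (by positivity)]
    calc |w t| * (c * t) ≤ |w t| * |p t| := mul_le_mul_of_nonneg_left h1 (abs_nonneg _)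
      _ = 1 := h3
  -- If the derivative of `p = 1 / w` stayed away from `0`, then `|p|` would grow at least linearly
  -- and `w` would be `O(1/t)`. With `p' → 0`, integration gives `p = o(t)`; the germ of `t` need
  -- not lie in the field.
  have hp0 : Tendsto p' atTop (𝓝 0) := by
    refine hH.tendsto_zero hp' (fun c hc hcp => ?_) fun c hc hcp => ?_
    · obtain ⟨c', hc', h1⟩ := exists_mul_pow_le_of_mul_pow_le_deriv (k := 0) hd
        ⟨c, hc, by simpa using hcp⟩
      refine hsmall c' hc' (h1.mono fun t ht => ?_)
      rw [zero_add, pow_one] at ht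
      exact ht.trans (le_abs_self _)
    · obtain ⟨c', hc', h1⟩ := exists_mul_pow_le_of_mul_pow_le_deriv (k := 0)
        (hd.mono fun t ht => ht.neg) ⟨c, hc, by simpa using hcp⟩
      refine hsmall c' hc' (h1.mono fun t ht => ?_)
      rw [zero_add, pow_one] at ht
      exact ht.trans (neg_le_abs _)
  rw [tendsto_atTop]
  intro B
  -- Chosen so that `|p t| ≤ 2 * c * t` becomes `t * |w t| ≥ |B| + 1`.
  set c : ℝ := (2 * (|B| + 1))⁻¹ with hc
  have hc0 : 0 < c := by positivity
  have hG : ∀ᶠ t : ℝ in atTop, HasDerivAt (fun t => c * t) c t :=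
    Eventually.of_forall fun t => by simpa using (hasDerivAt_id t).const_mul c
  have htop : Tendsto (fun t : ℝ => c * t) atTop atTop := tendsto_id.const_mul_atTop hc0
  filter_upwards [eventually_le_two_mul_of_deriv_le hd hG (hp0.eventually_le_const hc0) htop,
    eventually_le_two_mul_of_deriv_le (hd.mono fun t ht => ht.neg) hG
      ((neg_zero (G := ℝ) ▸ hp0.neg).eventually_le_const hc0) htop, hwp, eventually_gt_atTop 0]
    with t h1 h2 h3 ht
  rw [Pi.neg_apply] at h2
  have h4 : |p t| ≤ 2 * (c * t) := abs_le.2 ⟨by linarith, h1⟩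
  have h5 : |w t| * |p t| = 1 := by rw [← abs_mul, h3, abs_one]
  have h6 : 1 ≤ |w t| * (2 * (c * t)) := by
    rw [← h5]
    exact mul_le_mul_of_nonneg_left h4 (abs_nonneg _)
  have h7 : |w t| * (2 * (c * t)) = t * |w t| / (|B| + 1) := by
    rw [hc]
    field_simp
  rw [h7, one_le_div (by positivity)] at h6
  linarith [le_abs_self B]

/-- A positive element of a Hardy field that tends to `0` is decreasing and convex near `+∞`. -/
theorem eventually_deriv_nonpos_and_nonneg (hH : IsHardyField H) {w w' w'' : ℝ → ℝ}
    (hw' : (w' : Germ atTop ℝ) ∈ H) (hw'' : (w'' : Germ atTop ℝ) ∈ H)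
    (hd : ∀ᶠ t in atTop, HasDerivAt w (w' t) t) (hd' : ∀ᶠ t in atTop, HasDerivAt w' (w'' t) t)
    (hpos : ∀ᶠ t in atTop, 0 < w t) (hlim : Tendsto w atTop (𝓝 0)) :
    (∀ᶠ t in atTop, w' t ≤ 0) ∧ ∀ᶠ t in atTop, 0 ≤ w'' t := by
  have hneg : ¬ ∀ᶠ t in atTop, 0 ≤ w' t := by
    intro h
    obtain ⟨T, hT⟩ := exists_monotoneOn_Ici_of_deriv_nonneg hd h
    obtain ⟨S, hS⟩ := eventually_atTop.1 (hpos.and (eventually_ge_atTop T))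
    have h1 : w S ≤ 0 := ge_of_tendsto hlim (by
      filter_upwards [eventually_ge_atTop S] with t ht
      exact hT (hS S le_rfl).2 (hS t ht).2 ht)
    exact absurd (hS S le_rfl).1 h1.not_gt
  have hw'neg : ∀ᶠ t in atTop, w' t < 0 := by
    rcases hH.eventually_sign hw' with h | h | h
    · exact absurd (h.mono fun t ht => ht.ge) hneg
    · exact absurd (h.mono fun t ht => ht.le) hneg
    · exact h
  refine ⟨hw'neg.mono fun t ht => ht.le, ?_⟩
  -- Otherwise `w'` would stay below a negative constant, and `w` would decrease linearly and become
  -- negative.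
  have hpos' : ¬ ∀ᶠ t in atTop, w'' t < 0 := by
    intro h
    obtain ⟨T, hT⟩ := exists_monotoneOn_Ici_of_deriv_nonneg (F := -w') (f := fun t => -w'' t)
      (hd'.mono fun t ht => ht.neg) (h.mono fun t ht => (neg_pos.2 ht).le)
    obtain ⟨S, hS⟩ := eventually_atTop.1 (hw'neg.and (eventually_ge_atTop T))
    obtain ⟨c, hc, h1⟩ := exists_mul_pow_le_of_mul_pow_le_deriv (k := 0) (F := -w)
      (f := fun t => -w' t) (hd.mono fun t ht => ht.neg) ⟨-w' S, neg_pos.2 (hS S le_rfl).1, by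
        filter_upwards [eventually_ge_atTop S] with t ht
        rw [pow_zero, mul_one]
        exact hT (hS S le_rfl).2 (hS t ht).2 ht⟩
    obtain ⟨t, ⟨h2, h3⟩, h4⟩ := ((h1.and hpos).and (eventually_gt_atTop 0)).exists
    rw [Pi.neg_apply, zero_add, pow_one] at h2
    have : 0 < c * t := mul_pos hc h4
    linarith
  rcases hH.eventually_sign hw'' with h | h | h
  · exact h.mono fun t ht => ht.ge
  · exact h.mono fun t ht => ht.le
  · exact absurd h hpos'

end IsHardyField

/-! ### From derivatives to finite differences -/

/-- Mean value theorem for iterated forward differences. -/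
theorem exists_fwdDiff_iter_eq {f : ℕ → ℝ → ℝ} {T : ℝ} {k : ℕ}
    (hf : ∀ i < k, ∀ t ≥ T, HasDerivAt (f i) (f (i + 1) t) t) {t : ℝ} (ht : T ≤ t) :
    ∃ ξ ∈ Set.Icc t (t + k), (fwdDiff 1)^[k] (f 0) t = f k ξ := by
  induction k generalizing f with
  | zero => exact ⟨t, by simp, rfl⟩
  | succ k ih =>
    -- The functions `fwdDiff 1 (f i)` again form a derivative chain; one ordinary mean value step
    -- on `[ξ, ξ + 1]` then finishes.
    obtain ⟨ξ, hξ, h⟩ := ih (f := fun i => fwdDiff 1 (f i)) fun i hi s hs =>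
      ((hf i (by omega) (s + 1) (by linarith)).comp_add_const s 1).sub (hf i (by omega) s hs)
    have hξT : T ≤ ξ := ht.trans hξ.1
    obtain ⟨η, hη, h2⟩ := exists_hasDerivAt_eq_slope (f k) (f (k + 1)) (lt_add_one ξ)
      (fun s hs => (hf k (by omega) s (hξT.trans hs.1)).continuousAt.continuousWithinAt)
      fun s hs => hf k (by omega) s (hξT.trans hs.1.le)
    refine ⟨η, ⟨hξ.1.trans hη.1.le, ?_⟩, ?_⟩
    · push_cast
      linarith [hη.2, hξ.2]
    · rw [Function.iterate_succ_apply, h, h2, fwdDiff]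
      simp

theorem fwdDiff_iter_comp_natCast_add (f : ℝ → ℝ) (M k n : ℕ) :
    (fwdDiff 1)^[k] (fun n : ℕ => f (n + M : ℕ)) n = (fwdDiff 1)^[k] f (n + M : ℕ) := by
  induction k generalizing f with
  | zero => rfl
  | succ k ih =>
    rw [Function.iterate_succ_apply, Function.iterate_succ_apply, ← ih]
    refine congrFun (congrArg _ (funext fun n => ?_)) n
    simp only [fwdDiff]
    congr 2
    push_cast
    ring

theorem exists_isConvexDecay_fwdDiff_iter {f : ℕ → ℝ → ℝ} {m : ℕ} (hf : IsDerivChain f)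
    (hpos : ∀ᶠ t in atTop, 0 < f m t) (hlim : Tendsto (f m) atTop (𝓝 0))
    (hmul : Tendsto (fun t => t * f m t) atTop atTop) (h1 : ∀ᶠ t in atTop, f (m + 1) t ≤ 0)
    (h2 : ∀ᶠ t in atTop, 0 ≤ f (m + 2) t) :
    ∃ M : ℕ, IsConvexDecay ((fwdDiff 1)^[m] fun n : ℕ => f 0 (n + M : ℕ)) := by
  have hall : ∀ᶠ t in atTop, ∀ i < m + 2, HasDerivAt (f i) (f (i + 1) t) t := by
    have := (eventually_all_finset (l := (atTop : Filter ℝ)) (Finset.range (m + 2))).2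
      fun i _ => hf i
    simpa only [Finset.mem_range] using this
  obtain ⟨T, hT⟩ := eventually_atTop.1 (((hall.and hpos).and (h1.and h2)))
  obtain ⟨M, hM⟩ := exists_nat_ge T
  have hMn : ∀ n : ℕ, T ≤ (n + M : ℕ) := fun n => by
    push_cast
    linarith [(Nat.cast_nonneg n : (0 : ℝ) ≤ n)]
  have hmv : ∀ k ≤ m + 2, ∀ n : ℕ, ∃ ξ ∈ Set.Icc ((n + M : ℕ) : ℝ) ((n + M : ℕ) + k),
      (fwdDiff 1)^[k] (fun n : ℕ => f 0 (n + M : ℕ)) n = f k ξ := by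
    intro k hk n
    rw [fwdDiff_iter_comp_natCast_add]
    exact exists_fwdDiff_iter_eq (T := T)
      (fun i hi t ht => (hT t ht).1.1 i (by omega)) (hMn n)
  set u : ℕ → ℝ := (fwdDiff 1)^[m] fun n : ℕ => f 0 (n + M : ℕ) with hu
  have hu1 : ∀ n, u (n + 1) - u n = (fwdDiff 1)^[m + 1] (fun n : ℕ => f 0 (n + M : ℕ)) n := by
    intro n
    rw [Function.iterate_succ_apply']
    rfl
  have hu2 : ∀ n, (u (n + 1 + 1) - u (n + 1)) - (u (n + 1) - u n)
      = (fwdDiff 1)^[m + 2] (fun n : ℕ => f 0 (n + M : ℕ)) n := by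
    intro n
    rw [Function.iterate_succ_apply', hu1, hu1]
    rfl
  choose ξ hξ huξ using hmv m (by omega)
  have hξtop : Tendsto ξ atTop atTop := by
    refine tendsto_atTop_mono (fun n => ?_) tendsto_natCast_atTop_atTop
    have := (hξ n).1
    push_cast at this
    linarith [(Nat.cast_nonneg M : (0 : ℝ) ≤ M)]
  refine ⟨M, antitone_nat_of_succ_le fun n => ?_, antitone_nat_of_succ_le fun n => ?_,
    fun n => ?_, ?_, ?_⟩
  · obtain ⟨η, hη, h⟩ := hmv (m + 1) (by omega) n
    rw [← hu1] at h
    linarith [(hT η ((hMn n).trans hη.1)).2.1]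
  · obtain ⟨η, hη, h⟩ := hmv (m + 2) le_rfl n
    rw [← hu2] at h
    linarith [(hT η ((hMn n).trans hη.1)).2.2]
  · rw [huξ]
    exact (hT _ ((hMn n).trans (hξ n).1)).1.2
  · exact (hlim.comp hξtop).congr fun n => (huξ n).symm
  -- The intermediate point satisfies `ξ n ≤ n + M + m ≤ 2 * n`, which costs the factor `1 / 2`.
  · refine tendsto_atTop_mono' atTop ?_ ((hmul.comp hξtop).const_mul_atTop one_half_pos)
    filter_upwards [eventually_ge_atTop (M + m)] with n hn
    have hn' : (M : ℝ) + m ≤ n := by exact_mod_cast hn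
    have h3 := (hξ n).2
    push_cast at h3
    have h4 : 0 < f m (ξ n) := (hT _ ((hMn n).trans (hξ n).1)).1.2
    change 1 / 2 * (ξ n * f m (ξ n)) ≤ n * u n
    rw [show u n = _ from huξ n]
    nlinarith

/-- If the derivative of order `l + 1` stayed away from `0`, repeated integration would contradict
`g ≺ t ^ (l + 1)` or positivity; if it were `O(1/t)`, integration would give `g = O(t ^ l * log t)`,
against the lower bound. The factor `σ` treats both signs of this derivative alike. -/
theorem HardyClassM.exists_isConvexDecay {l : ℕ} {g : ℝ → ℝ} (hg : g ∈ HardyClassM l) :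
    ∃ (σ : ℝ) (M : ℕ), σ * σ = 1 ∧
      IsConvexDecay ((fwdDiff 1)^[l + 1] fun n : ℕ => σ * g (n + M : ℕ)) := by
  obtain ⟨⟨H, hH, hgH⟩, hpos, hlow, hup⟩ := hg
  obtain ⟨f, rfl, hfH, hf⟩ := hH.exists_isDerivChain hgH
  have hlim : Tendsto (f (l + 1)) atTop (𝓝 0) := by
    refine hH.tendsto_zero (hfH _) (fun c hc h => ?_) fun c hc h => ?_
    · obtain ⟨c', hc', h1⟩ := hf.exists_mul_pow_le (k := 0) ⟨c, hc, by simpa using h⟩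
      obtain ⟨t, ⟨h2, h3⟩, h4⟩ :=
        ((h1.and (hup.eventually_lt_const hc')).and (eventually_gt_atTop 0)).exists
      rw [div_lt_iff₀ (by positivity)] at h3
      rw [zero_add] at h2
      linarith
    · obtain ⟨c', hc', h1⟩ := hf.neg.exists_mul_pow_le (m := l + 1) (k := 0)
        ⟨c, hc, by simpa using h⟩
      obtain ⟨t, ⟨h2, h3⟩, h4⟩ := ((h1.and hpos).and (eventually_gt_atTop 0)).exists
      rw [Pi.neg_apply] at h2
      have : 0 < c' * t ^ (0 + (l + 1)) := by positivity
      linarith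
  have hbig : ¬ ∃ C > 0, ∀ᶠ t in atTop, |f (l + 1) t| ≤ C * t⁻¹ := by
    intro h
    obtain ⟨C, hC, h1⟩ := hf.exists_abs_le_pow_mul_log (exists_abs_le_log_of_deriv (hf l) h)
    obtain ⟨t, ⟨⟨h2, h3⟩, h4⟩, h5⟩ := (((h1.and (hlow.eventually_lt_const
      (inv_pos.2 hC))).and hpos).and (eventually_gt_atTop 1)).exists
    rw [div_lt_iff₀ h4, inv_mul_eq_div, lt_div_iff₀ hC] at h3
    rw [zero_add] at h2
    linarith [le_abs_self (f 0 t)]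
  have hmul := hH.tendsto_mul_abs_atTop (hfH (l + 1)) hbig
  rcases hH.eventually_sign (hfH (l + 1)) with h | h | h
  · refine absurd ⟨1, one_pos, ?_⟩ hbig
    filter_upwards [h, eventually_gt_atTop 0] with t ht ht0
    rw [ht, Pi.zero_apply, abs_zero]
    positivity
  · obtain ⟨h1, h2⟩ := hH.eventually_deriv_nonpos_and_nonneg (hfH _) (hfH _) (hf (l + 1))
      (hf (l + 2)) h hlim
    obtain ⟨M, hM⟩ := exists_isConvexDecay_fwdDiff_iter hf h hlim
      (hmul.congr' (h.mono fun t ht => by simp only [abs_of_pos ht])) h1 h2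
    exact ⟨1, M, one_mul 1, by simpa only [one_mul] using hM⟩
  · have hpos' : ∀ᶠ t in atTop, 0 < (-f (l + 1)) t := h.mono fun t ht => neg_pos.2 ht
    have hlim' : Tendsto (-f (l + 1)) atTop (𝓝 0) := neg_zero (G := ℝ) ▸ hlim.neg
    obtain ⟨h1, h2⟩ := hH.eventually_deriv_nonpos_and_nonneg (w' := -f (l + 2)) (w'' := -f (l + 3))
      (neg_mem (hfH _)) (neg_mem (hfH _)) (hf.neg (l + 1)) (hf.neg (l + 2)) hpos' hlim'
    obtain ⟨M, hM⟩ := exists_isConvexDecay_fwdDiff_iter hf.neg hpos' hlim'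
      (hmul.congr' (h.mono fun t ht => by simp only [abs_of_neg ht]; rfl)) h1 h2
    exact ⟨-1, M, by norm_num, by simpa only [neg_one_mul, Pi.neg_apply] using hM⟩

/-! ### Weyl's criterion and pattern frequencies -/

section Density

theorem exists_tendsto_of_approx {E : Type*} [NormedAddCommGroup E] [CompleteSpace E] {t : ℕ → E}
    (h : ∀ ε > 0, ∃ (s : ℕ → E) (L : E), Tendsto s atTop (𝓝 L) ∧
      ∀ᶠ N in atTop, ‖t N - s N‖ ≤ ε) : ∃ L, Tendsto t atTop (𝓝 L) := by
  refine cauchySeq_tendsto_of_complete (Metric.cauchySeq_iff'.2 fun ε hε => ?_)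
  obtain ⟨s, L, hs, hts⟩ := h (ε / 4) (by positivity)
  obtain ⟨N, hN⟩ := eventually_atTop.1
    (hts.and (hs.eventually (Metric.ball_mem_nhds L (show 0 < ε / 8 by positivity))))
  refine ⟨N, fun n hn => ?_⟩
  obtain ⟨h1, h2⟩ := hN n hn
  obtain ⟨h3, h4⟩ := hN N le_rfl
  rw [← dist_eq_norm] at h1 h3
  have h5 := dist_triangle4 (t n) (s n) (s N) (t N)
  have h6 := dist_triangle_right (s n) (s N) L
  rw [dist_comm (s N)] at h5
  linarith

theorem tendsto_of_approx {E : Type*} [NormedAddCommGroup E] {t : ℕ → E} {L : E}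
    (h : ∀ ε > 0, ∃ (s : ℕ → E) (L' : E), Tendsto s atTop (𝓝 L') ∧ ‖L - L'‖ ≤ ε ∧
      ∀ᶠ N in atTop, ‖t N - s N‖ ≤ ε) : Tendsto t atTop (𝓝 L) := by
  rw [Metric.tendsto_nhds]
  intro ε hε
  obtain ⟨s, L', hs, hL, hts⟩ := h (ε / 4) (by positivity)
  filter_upwards [hts, hs.eventually (Metric.ball_mem_nhds L' (show 0 < ε / 4 by positivity))]
    with N h1 h2
  rw [← dist_eq_norm] at h1 hL
  have h5 := dist_triangle4 (t N) (s N) L' L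
  rw [dist_comm L' L] at h5
  linarith

theorem norm_cesaroMean_comp_sub_le {X : Type*} [TopologicalSpace X] [CompactSpace X]
    (F G : C(X, ℂ)) (y : ℕ → X) (N : ℕ) :
    ‖cesaroMean (fun n => F (y n)) N - cesaroMean (fun n => G (y n)) N‖ ≤ ‖F - G‖ := by
  rw [← cesaroMean_sub]
  exact norm_cesaroMean_le (norm_nonneg _) (fun n => (F - G).norm_coe_le_norm (y n)) N

theorem cesaroMean_comp_add {X : Type*} [TopologicalSpace X] (F G : C(X, ℂ)) (y : ℕ → X) :
    cesaroMean (fun n => (F + G) (y n))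
      = fun N => cesaroMean (fun n => F (y n)) N + cesaroMean (fun n => G (y n)) N := by
  ext N
  simp [cesaroMean, Finset.sum_add_distrib]

theorem cesaroMean_comp_smul {X : Type*} [TopologicalSpace X] (c : ℂ) (F : C(X, ℂ)) (y : ℕ → X) :
    cesaroMean (fun n => (c • F) (y n)) = fun N => c • cesaroMean (fun n => F (y n)) N := by
  ext N
  simp [cesaroMean, ← Finset.mul_sum, mul_left_comm]

/-- Cesàro averages are linear and contract the supremum norm, so the functions whose averages
converge form a closed subspace. -/
theorem exists_tendsto_cesaroMean_comp_of_span {X : Type*} [TopologicalSpace X] [CompactSpace X]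
    {S : Set C(X, ℂ)} (hS : (Submodule.span ℂ S).topologicalClosure = ⊤) {y : ℕ → X}
    (h : ∀ F ∈ S, ∃ L, Tendsto (cesaroMean fun n => F (y n)) atTop (𝓝 L)) (F : C(X, ℂ)) :
    ∃ L, Tendsto (cesaroMean fun n => F (y n)) atTop (𝓝 L) := by
  have hspan : ∀ G ∈ Submodule.span ℂ S,
      ∃ L, Tendsto (cesaroMean fun n => G (y n)) atTop (𝓝 L) := by
    intro G hG
    induction hG using Submodule.span_induction with
    | mem G hG => exact h G hG
    | zero => exact ⟨0, Tendsto.cesaroMean (by simp)⟩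
    | add G₁ G₂ _ _ h1 h2 =>
      obtain ⟨L₁, h1⟩ := h1
      obtain ⟨L₂, h2⟩ := h2
      exact ⟨L₁ + L₂, by rw [cesaroMean_comp_add]; exact h1.add h2⟩
    | smul c G _ h1 =>
      obtain ⟨L, h1⟩ := h1
      exact ⟨c • L, by rw [cesaroMean_comp_smul]; exact h1.const_smul c⟩
  refine exists_tendsto_of_approx fun ε hε => ?_
  have hF : F ∈ closure (Submodule.span ℂ S : Set C(X, ℂ)) := by
    rw [← Submodule.topologicalClosure_coe, hS]
    trivial
  obtain ⟨G, hG, hFG⟩ := Metric.mem_closure_iff.1 hF ε hε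
  obtain ⟨L, hL⟩ := hspan G hG
  refine ⟨_, L, hL, Eventually.of_forall fun N => ?_⟩
  rw [dist_eq_norm] at hFG
  exact (norm_cesaroMean_comp_sub_le F G y N).trans hFG.le

open MeasureTheory AddCircle

/-- Weyl's criterion, for continuous test functions on the circle. -/
theorem tendsto_cesaroMean_comp_integral {x : ℕ → UnitAddCircle}
    (h : ∀ k : ℤ, k ≠ 0 → Tendsto (cesaroMean fun n => fourier k (x n)) atTop (𝓝 0))
    (F : C(UnitAddCircle, ℂ)) :
    Tendsto (cesaroMean fun n => F (x n)) atTop (𝓝 (∫ z, F z ∂haarAddCircle)) := by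
  have hint : ∀ G : C(UnitAddCircle, ℂ), Integrable G haarAddCircle :=
    fun G => G.continuous.integrable_of_hasCompactSupport (HasCompactSupport.of_compactSpace _)
  have hfour : ∀ k : ℤ, ∫ z : UnitAddCircle, fourier k z ∂haarAddCircle = if k = 0 then 1 else 0 := by
    intro k
    have h1 := congrFun (fourierCoeff_fourier (T := 1) k) 0
    simp only [fourierCoeff, neg_zero, fourier_zero, one_smul, Pi.single_apply] at h1
    rw [h1]
    simp only [eq_comm]
  have hspan : ∀ G ∈ Submodule.span ℂ (Set.range (fourier (T := 1))),
      Tendsto (cesaroMean fun n => G (x n)) atTop (𝓝 (∫ z, G z ∂haarAddCircle)) := by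
    intro G hG
    induction hG using Submodule.span_induction with
    | mem G hG =>
      obtain ⟨k, rfl⟩ := hG
      rw [hfour]
      split_ifs with hk
      · subst hk
        exact Tendsto.cesaroMean (by simp)
      · exact h k hk
    | zero => exact Tendsto.cesaroMean (by simp)
    | add G₁ G₂ _ _ h1 h2 =>
      rw [cesaroMean_comp_add]
      simp only [ContinuousMap.add_apply]
      rw [integral_add (hint _) (hint _)]
      exact h1.add h2
    | smul c G _ h1 =>
      rw [cesaroMean_comp_smul]
      simp only [ContinuousMap.smul_apply]
      rw [integral_smul]
      exact h1.const_smul c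
  refine tendsto_of_approx fun ε hε => ?_
  have hF : F ∈ closure (Submodule.span ℂ (Set.range (fourier (T := 1))) :
      Set C(UnitAddCircle, ℂ)) := by
    rw [← Submodule.topologicalClosure_coe, span_fourier_closure_eq_top]
    trivial
  obtain ⟨G, hG, hFG⟩ := Metric.mem_closure_iff.1 hF ε hε
  rw [dist_eq_norm] at hFG
  refine ⟨_, _, hspan G hG, ?_, Eventually.of_forall fun N =>
    (norm_cesaroMean_comp_sub_le F G x N).trans hFG.le⟩
  rw [← integral_sub (hint F) (hint G)]
  refine (norm_integral_le_of_norm_le_const (C := ε) (Eventually.of_forall fun z => ?_)).trans ?_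
  · exact ((F - G).norm_coe_le_norm z).trans hFG.le
  · simp

theorem tendsto_cesaroMean_comp_integral_real {x : ℕ → UnitAddCircle}
    (h : ∀ k : ℤ, k ≠ 0 → Tendsto (cesaroMean fun n => fourier k (x n)) atTop (𝓝 0))
    (F : C(UnitAddCircle, ℝ)) :
    Tendsto (cesaroMean fun n => F (x n)) atTop (𝓝 (∫ z, F z ∂haarAddCircle)) := by
  have h1 := tendsto_cesaroMean_comp_integral h ⟨fun z => (F z : ℂ), by fun_prop⟩
  have h2 := (Complex.continuous_re.tendsto _).comp h1
  simp only [ContinuousMap.coe_mk] at h2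
  rw [integral_complex_ofReal, Complex.ofReal_re] at h2
  refine h2.congr fun N => ?_
  simp [cesaroMean, ← Complex.ofReal_sum]

/-- A set with null frontier has an indicator function that is `L¹`-close to a continuous one. -/
theorem exists_continuousMap_of_null_frontier {I : Set UnitAddCircle}
    (hI : haarAddCircle (frontier I) = 0) {ε : ℝ} (hε : 0 < ε) :
    ∃ p q : C(UnitAddCircle, ℝ), (∀ z, p z ∈ Set.Icc (0 : ℝ) 1) ∧
      (∀ z, |I.indicator 1 z - p z| ≤ q z) ∧ ∫ z, q z ∂haarAddCircle ≤ ε := by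
  have h1 := tendsto_measure_thickening_of_isClosed (μ := haarAddCircle) (s := frontier I)
    ⟨1, one_pos, measure_ne_top _ _⟩ isClosed_frontier
  rw [hI] at h1
  obtain ⟨δ, hδ1, hδ⟩ := ((h1.eventually_lt_const (ENNReal.ofReal_pos.2 hε)).and
    self_mem_nhdsWithin).exists
  set q₀ := thickenedIndicator hδ (frontier I)
  have hq₀ : ∀ z, q₀ z ≤ 1 := thickenedIndicator_le_one hδ _
  let q : C(UnitAddCircle, ℝ) := ⟨fun z => q₀ z, by fun_prop⟩
  have hq1 : ∀ z, q z ≤ 1 := fun z => NNReal.coe_le_one.2 (hq₀ z)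
  have hq0 : ∀ z, 0 ≤ q z := fun z => (q₀ z).2
  have hqf : ∀ z ∈ frontier I, 1 - q z = 0 := by
    intro z hz
    have : q₀ z = 1 := thickenedIndicator_one hδ _ hz
    change 1 - (q₀ z : ℝ) = 0
    rw [this]
    simp
  -- Multiplying the indicator of `I` by `1 - q`, which vanishes on the frontier, makes it
  -- continuous and changes it by at most `q`.
  refine ⟨⟨I.indicator fun z => 1 - q z, continuous_indicator hqf (by fun_prop)⟩, q,
    fun z => ?_, fun z => ?_, ?_⟩
  · by_cases hz : z ∈ I
    · simpa [hz] using ⟨hq1 z, hq0 z⟩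
    · simp [hz]
  · by_cases hz : z ∈ I
    · simp [hz, abs_of_nonneg (hq0 z)]
    · simpa [hz] using hq0 z
  · have hmeas : MeasurableSet (Metric.thickening δ (frontier I)) :=
      Metric.isOpen_thickening.measurableSet
    calc ∫ z, q z ∂haarAddCircle
        ≤ ∫ z, (Metric.thickening δ (frontier I)).indicator 1 z ∂haarAddCircle := by
          refine integral_mono (q.continuous.integrable_of_hasCompactSupport
            (HasCompactSupport.of_compactSpace _))
            ((integrable_const 1).indicator hmeas) fun z => ?_
          by_cases hz : z ∈ Metric.thickening δ (frontier I)
          · simpa [hz] using hq1 z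
          · have : q₀ z = 0 := thickenedIndicator_zero hδ _ hz
            simp only [hz, not_false_eq_true, Set.indicator_of_notMem]
            change (q₀ z : ℝ) ≤ 0
            rw [this]
            simp
      _ = haarAddCircle.real (Metric.thickening δ (frontier I)) := integral_indicator_one hmeas
      _ ≤ ε := ENNReal.toReal_le_of_le_ofReal hε.le hδ1.le

theorem abs_prod_sub_prod_le {ι : Type*} (s : Finset ι) {f g : ι → ℝ}
    (hf : ∀ i, f i ∈ Set.Icc (0 : ℝ) 1) (hg : ∀ i, g i ∈ Set.Icc (0 : ℝ) 1) :
    |∏ i ∈ s, f i - ∏ i ∈ s, g i| ≤ ∑ i ∈ s, |f i - g i| := by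
  classical
  induction s using Finset.induction_on with
  | empty => simp
  | insert i s hi ih =>
    rw [Finset.prod_insert hi, Finset.prod_insert hi, Finset.sum_insert hi]
    have h1 : |∏ j ∈ s, f j| ≤ 1 := by
      rw [abs_of_nonneg (Finset.prod_nonneg fun j _ => (hf j).1)]
      exact Finset.prod_le_one (fun j _ => (hf j).1) fun j _ => (hf j).2
    have h2 : |g i| ≤ 1 := by
      rw [abs_of_nonneg (hg i).1]
      exact (hg i).2
    calc _ = |(f i - g i) * ∏ j ∈ s, f j + g i * (∏ j ∈ s, f j - ∏ j ∈ s, g j)| := by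
          congr 1
          ring
      _ ≤ |f i - g i| * |∏ j ∈ s, f j| + |g i| * |∏ j ∈ s, f j - ∏ j ∈ s, g j| := by
          rw [← abs_mul, ← abs_mul]
          exact abs_add_le _ _
      _ ≤ |f i - g i| * 1 + 1 * |∏ j ∈ s, f j - ∏ j ∈ s, g j| := by gcongr
      _ ≤ _ := by linarith

open Classical in
/-- The pattern frequencies of a sequence on the circle in a set with null frontier exist, provided
that the Weyl sums of the orbits of finite windows converge. -/
theorem exists_tendsto_cesaroMean_pattern {x : ℕ → UnitAddCircle}
    (h : ∀ k : ℤ, k ≠ 0 → Tendsto (cesaroMean fun n => fourier k (x n)) atTop (𝓝 0)) (K : ℕ)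
    (hK : ∀ c : Fin (K + 1) → ℤ, ∃ L,
      Tendsto (cesaroMean fun n => ∏ i, fourier (c i) (x (n + i))) atTop (𝓝 L))
    {I : Set UnitAddCircle} (hI : haarAddCircle (frontier I) = 0) (B : Set ℕ) :
    ∃ d : ℝ, Tendsto (cesaroMean
      ({n : ℕ | ∀ j ∈ Set.Icc 0 K, (x (n + j) ∈ I ↔ j ∈ B)}.indicator 1)) atTop (𝓝 d) := by
  -- The window orbit need not equidistribute on the torus; only convergence of its averages is
  -- needed.
  have htorus := exists_tendsto_cesaroMean_comp_of_span
    (UnitAddTorus.span_mFourier_closure_eq_top (d := Fin (K + 1)))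
    (y := fun n i => x (n + i)) (by
      rintro _ ⟨c, rfl⟩
      exact hK c)
  refine exists_tendsto_of_approx fun ε hε => ?_
  obtain ⟨p, q, hp, hpq, hq⟩ := exists_continuousMap_of_null_frontier hI
    (show 0 < ε / (2 * (K + 1)) by positivity)
  let χ : ℕ → UnitAddCircle → ℝ := fun j z =>
    if j ∈ B then I.indicator 1 z else 1 - I.indicator 1 z
  let P : ℕ → UnitAddCircle → ℝ := fun j z => if j ∈ B then p z else 1 - p z
  have hχ : ∀ j z, χ j z ∈ Set.Icc (0 : ℝ) 1 := by
    intro j z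
    by_cases hj : j ∈ B <;> by_cases hz : z ∈ I <;> simp [χ, hj, hz]
  have hP : ∀ j z, P j z ∈ Set.Icc (0 : ℝ) 1 := by
    intro j z
    by_cases hj : j ∈ B
    · simpa [P, hj] using hp z
    · simpa [P, hj, and_comm] using hp z
  have hχP : ∀ j z, |χ j z - P j z| ≤ q z := by
    intro j z
    by_cases hj : j ∈ B
    · simpa [P, χ, hj] using hpq z
    · have := hpq z
      rw [abs_sub_comm] at this
      simpa [P, χ, hj] using this
  have hPcont : ∀ j, Continuous (P j) := by
    intro j
    by_cases hj : j ∈ B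
    · simpa [P, hj] using p.continuous
    · simp only [P, hj, if_false]
      fun_prop
  -- The pattern indicator is a product over the window, so its approximation error is at most the
  -- sum of the coordinate errors `q (x (n + i))`. Each has mean tending to `∫ q`, by
  -- equidistribution on the circle alone.
  have hind : ∀ n, {n : ℕ | ∀ j ∈ Set.Icc 0 K, (x (n + j) ∈ I ↔ j ∈ B)}.indicator
      (1 : ℕ → ℝ) n = ∏ i : Fin (K + 1), χ i (x (n + i)) := by
    intro n
    by_cases hn : ∀ j ∈ Set.Icc 0 K, (x (n + j) ∈ I ↔ j ∈ B)
    · rw [Set.indicator_of_mem (by exact hn), Finset.prod_eq_one, Pi.one_apply]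
      intro i _
      have := hn i ⟨Nat.zero_le _, by omega⟩
      by_cases hi : (i : ℕ) ∈ B
      · simp [χ, hi, this.2 hi]
      · simp [χ, hi, mt this.1 hi]
    · rw [Set.indicator_of_notMem (by exact hn)]
      push Not at hn
      obtain ⟨j, hj, h1⟩ := hn
      symm
      refine Finset.prod_eq_zero (Finset.mem_univ (⟨j, by have := hj.2; omega⟩ : Fin (K + 1))) ?_
      rcases h1 with ⟨h1, h2⟩ | ⟨h1, h2⟩
      · simp [χ, h1, h2]
      · simp [χ, h1, h2]
  obtain ⟨L, hL⟩ := htorus ⟨fun y => ∏ i : Fin (K + 1), (P i (y i) : ℂ), by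
    refine continuous_finsetProd _ fun i _ => ?_
    exact Complex.continuous_ofReal.comp ((hPcont i).comp (continuous_apply i))⟩
  have hL' := (Complex.continuous_re.tendsto _).comp hL
  refine ⟨_, L.re, hL', ?_⟩
  have hqlim : Tendsto (fun N => ∑ i : Fin (K + 1), cesaroMean (fun n => q (x (n + i))) N) atTop
      (𝓝 (∑ i : Fin (K + 1), ∫ z, q z ∂haarAddCircle)) := by
    refine tendsto_finsetSum _ fun i _ => ?_
    exact (tendsto_cesaroMean_shift_iff (f := fun n => q (x n)) (C := ‖q‖)
      (fun n => q.norm_coe_le_norm _) i _).2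
      (tendsto_cesaroMean_comp_integral_real h q)
  have hqε : ∑ i : Fin (K + 1), ∫ z, q z ∂haarAddCircle < ε := by
    simp only [Finset.sum_const, Finset.card_univ, Fintype.card_fin, nsmul_eq_mul]
    calc ((K + 1 : ℕ) : ℝ) * ∫ z, q z ∂haarAddCircle
        ≤ (K + 1 : ℕ) * (ε / (2 * (K + 1))) := by gcongr
      _ = ε / 2 := by push_cast; field_simp
      _ < ε := by linarith
  filter_upwards [hqlim.eventually_lt_const hqε] with N hN
  refine le_trans ?_ hN.le
  have hre : (Complex.re ∘ cesaroMean fun n => ∏ i : Fin (K + 1), (P i (x (n + i)) : ℂ)) N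
      = cesaroMean (fun n => ∏ i : Fin (K + 1), P i (x (n + i))) N := by
    simp only [Function.comp, cesaroMean, Complex.smul_re, Complex.re_sum,
      ← Complex.ofReal_prod, Complex.ofReal_re]
  have hfun : {n : ℕ | ∀ j ∈ Set.Icc 0 K, (x (n + j) ∈ I ↔ j ∈ B)}.indicator
      (1 : ℕ → ℝ) = fun n => ∏ i : Fin (K + 1), χ i (x (n + i)) := funext hind
  simp only [ContinuousMap.coe_mk]
  rw [hre, hfun, ← cesaroMean_sub, ← cesaroMean_sum, cesaroMean, cesaroMean, norm_smul,
    Real.norm_of_nonneg (by positivity), smul_eq_mul]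
  refine mul_le_mul_of_nonneg_left (norm_sum_le_of_le _ fun n _ => ?_) (by positivity)
  exact (abs_prod_sub_prod_le Finset.univ (fun i : Fin (K + 1) => hχ i (x (n + i)))
    fun i => hP i (x (n + i))).trans (Finset.sum_le_sum fun i _ => hχP i (x (n + i)))

/-- A Urysohn bump supported in `I` bounds the frequency below by its positive integral. -/
theorem pos_of_tendsto_cesaroMean_indicator {x : ℕ → UnitAddCircle}
    (h : ∀ k : ℤ, k ≠ 0 → Tendsto (cesaroMean fun n => fourier k (x n)) atTop (𝓝 0))
    {I : Set UnitAddCircle} (hI : (interior I).Nonempty) {d : ℝ}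
    (hd : Tendsto (cesaroMean ({n : ℕ | x n ∈ I}.indicator 1)) atTop (𝓝 d)) : 0 < d := by
  obtain ⟨z, hz⟩ := hI
  obtain ⟨p, hp0, hp1, hp⟩ := exists_continuous_zero_one_of_isClosed
    (isOpen_interior (s := I)).isClosed_compl (isClosed_singleton (x := z))
    (Set.disjoint_singleton_right.2 fun h => h hz)
  have hpos : 0 < ∫ z, p z ∂haarAddCircle :=
    p.continuous.integral_pos_of_hasCompactSupport_nonneg_nonzero
      (HasCompactSupport.of_compactSpace _) (fun z => (hp z).1) (x := z) (by simp [hp1 rfl])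
  refine hpos.trans_le (le_of_tendsto_of_tendsto' (tendsto_cesaroMean_comp_integral_real h p) hd
    fun N => ?_)
  refine mul_le_mul_of_nonneg_left (Finset.sum_le_sum fun n _ => ?_) (by positivity)
  by_cases hn : x n ∈ I
  · simpa [hn] using (hp (x n)).2
  · have : p (x n) = 0 := hp0 fun h => hn (interior_subset h)
    simp [hn, this]

theorem hasDensity_of_tendsto_cesaroMean {A : Set ℕ} {M : ℕ} {d : ℝ}
    (h : Tendsto (cesaroMean fun n => A.indicator (1 : ℕ → ℝ) (n + M)) atTop (𝓝 d)) :
    HasDensity A d := by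
  classical
  have hb : ∀ n, ‖A.indicator (1 : ℕ → ℝ) n‖ ≤ 1 := by
    intro n
    by_cases hn : n ∈ A <;> simp [hn]
  -- The further shift by `1` passes from `{0, …, N - 1}` to `{1, …, N}`.
  have h1 := (tendsto_cesaroMean_shift_iff hb 1 d).2 ((tendsto_cesaroMean_shift_iff hb M d).1 h)
  refine h1.congr fun N => ?_
  have h2 : A ∩ Set.Icc 1 N = ((Finset.Icc 1 N).filter (· ∈ A) : Finset ℕ) := by
    ext n
    rw [Finset.coe_filter, Set.inter_comm]
    simp only [Finset.mem_Icc]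
    rfl
  rw [h2, Set.ncard_coe_finset, Finset.card_filter, cesaroMean, smul_eq_mul, inv_mul_eq_div,
    Finset.range_eq_Ico, Finset.sum_Ico_add' (fun n => A.indicator (1 : ℕ → ℝ) n), zero_add]
  congr 1
  push_cast
  refine Finset.sum_congr (by ext; simp) fun n _ => ?_
  by_cases hn : n ∈ A <;> simp [hn]

end Density

/-! ### Arcs of the circle -/

section CircleInterval

open MeasureTheory AddCircle

theorem haarAddCircle_singleton (z : UnitAddCircle) : haarAddCircle {z} = 0 := by
  have h1 : ∀ ε : ℝ, 0 < ε → volume ({z} : Set UnitAddCircle) ≤ ENNReal.ofReal (2 * ε) := by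
    intro ε hε
    calc volume ({z} : Set UnitAddCircle) ≤ volume (Metric.closedBall z ε) :=
          measure_mono (Set.singleton_subset_iff.2 (Metric.mem_closedBall_self hε.le))
      _ ≤ _ := by
          rw [AddCircle.volume_closedBall]
          exact ENNReal.ofReal_le_ofReal (min_le_right _ _)
  have h2 : volume ({z} : Set UnitAddCircle) = 0 := by
    refine le_antisymm (le_of_forall_gt fun c hc => ?_) zero_le
    obtain ⟨r, hr, hrc⟩ := ENNReal.lt_iff_exists_real_btwn.1 hc
    have hr0 : 0 < r := ENNReal.ofReal_pos.1 hrc.1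
    have := h1 (r / 2) (by positivity)
    rw [mul_div_cancel₀ _ two_ne_zero] at this
    exact this.trans_lt hrc.2
  rw [volume_eq_smul_haarAddCircle] at h2
  simpa using h2

theorem image_coe_eq_univ {J : Set ℝ} {t : ℝ} (h : Set.Icc t (t + 1) ⊆ J) :
    ((↑) : ℝ → UnitAddCircle) '' J = Set.univ :=
  Set.eq_univ_of_univ_subset ((AddCircle.coe_image_Icc_eq (1 : ℝ) t).symm.subset.trans
    (Set.image_mono h))

/-- If `J` is unbounded its image is the whole circle. Otherwise the frontier lies in the images of
the two endpoints, whether or not `J` wraps around. -/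
theorem haarAddCircle_frontier_image_coe {J : Set ℝ} (hJ : J.OrdConnected) (hne : J.Nonempty) :
    haarAddCircle (frontier (((↑) : ℝ → UnitAddCircle) '' J)) = 0 := by
  obtain ⟨t, ht⟩ := hne
  by_cases habove : BddAbove J
  swap
  · obtain ⟨s, hs, hts⟩ := not_bddAbove_iff.1 habove (t + 1)
    rw [image_coe_eq_univ ((Set.Icc_subset_Icc_right hts.le).trans (hJ.out ht hs))]
    simp
  by_cases hbelow : BddBelow J
  swap
  · obtain ⟨s, hs, hts⟩ := not_bddBelow_iff.1 hbelow (t - 1)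
    rw [image_coe_eq_univ ((Set.Icc_subset_Icc_right (show s + 1 ≤ t by linarith)).trans
      (hJ.out hs ht))]
    simp
  have h1 : Set.Ioo (sInf J) (sSup J) ⊆ J :=
    IsConnected.Ioo_csInf_csSup_subset ⟨⟨t, ht⟩, hJ.isPreconnected⟩ hbelow habove
  have h2 : J ⊆ Set.Icc (sInf J) (sSup J) := subset_Icc_csInf_csSup hbelow habove
  have hopen : IsOpen (((↑) : ℝ → UnitAddCircle) '' Set.Ioo (sInf J) (sSup J)) :=
    QuotientAddGroup.isOpenMap_coe _ isOpen_Ioo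
  have hclosed : IsClosed (((↑) : ℝ → UnitAddCircle) '' Set.Icc (sInf J) (sSup J)) :=
    (isCompact_Icc.image (AddCircle.continuous_mk' 1)).isClosed
  have h3 : frontier (((↑) : ℝ → UnitAddCircle) '' J)
      ⊆ {((sInf J : ℝ) : UnitAddCircle)} ∪ {((sSup J : ℝ) : UnitAddCircle)} := by
    intro z hz
    obtain ⟨s, hs, rfl⟩ := closure_minimal (Set.image_mono h2) hclosed hz.1
    have h4 : s ∉ Set.Ioo (sInf J) (sSup J) := fun h =>
      hz.2 (interior_maximal (Set.image_mono h1) hopen ⟨s, h, rfl⟩)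
    rcases eq_or_lt_of_le hs.1 with h5 | h5
    · exact Or.inl (by rw [h5]; rfl)
    · rcases eq_or_lt_of_le hs.2 with h6 | h6
      · exact Or.inr (by rw [h6]; rfl)
      · exact absurd ⟨h5, h6⟩ h4
  refine measure_mono_null h3 (measure_union_null ?_ ?_) <;> exact haarAddCircle_singleton _

theorem nonempty_interior_image_coe {J : Set ℝ} (hJ : J.OrdConnected) (hJ' : J.Nontrivial) :
    (interior (((↑) : ℝ → UnitAddCircle) '' J)).Nonempty := by
  obtain ⟨s, hs, t, ht, hst⟩ := hJ'.exists_lt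
  have h1 : Set.Ioo s t ⊆ J := Set.Ioo_subset_Icc_self.trans (hJ.out hs ht)
  exact (((Set.nonempty_Ioo.2 hst).image _).mono
    (interior_maximal (Set.image_mono h1) (QuotientAddGroup.isOpenMap_coe _ isOpen_Ioo)))

theorem circleE_eq_toCircle (t : ℝ) : circleE t = toCircle (t : UnitAddCircle) := by
  rw [toCircle_apply_mk, circleE, div_one]

theorem circleE_mem_image_iff (t : ℝ) (J : Set ℝ) :
    circleE t ∈ circleE '' J ↔ (t : UnitAddCircle) ∈ ((↑) : ℝ → UnitAddCircle) '' J := by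
  simp only [Set.mem_image, circleE_eq_toCircle, (injective_toCircle one_ne_zero).eq_iff]

end CircleInterval

/-! ### Conclusion -/

theorem fourier_coe_eq_expChar (k : ℤ) (t : ℝ) :
    fourier k (t : UnitAddCircle) = expChar (k * t) := by
  rw [fourier_coe_apply, expChar]
  congr 1
  push_cast
  ring

theorem expChar_sum {ι : Type*} (s : Finset ι) (f : ι → ℝ) :
    expChar (∑ i ∈ s, f i) = ∏ i ∈ s, expChar (f i) := by
  classical
  induction s using Finset.induction_on with
  | empty => simp [expChar_zero]
  | insert i s hi ih => rw [Finset.sum_insert hi, Finset.prod_insert hi, expChar_add, ih]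

theorem theorem4p8 (l : ℕ) (g : ℝ → ℝ) (hg : g ∈ HardyClassM l) : PropertyQ g := by
  obtain ⟨σ, M, hσ, ha⟩ := HardyClassM.exists_isConvexDecay hg
  set a : ℕ → ℝ := fun n => σ * g (n + M : ℕ) with haM
  set x : ℕ → UnitAddCircle := fun n => (g (n + M : ℕ) : ℝ) with hx
  have hga : ∀ n, g (n + M : ℕ) = σ * a n := fun n => by rw [haM, ← mul_assoc, hσ, one_mul]
  have hσ0 : σ ≠ 0 := left_ne_zero_of_mul (hσ.trans_ne one_ne_zero)
  have hweyl : ∀ k : ℤ, k ≠ 0 → Tendsto (cesaroMean fun n => fourier k (x n)) atTop (𝓝 0) := by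
    intro k hk
    have := ha.tendsto_cesaroMean_expChar_of_eval_ne_zero (Nat.succ_pos l)
      (P := Polynomial.C (k * σ)) (by
        rw [Polynomial.eval_C]
        exact mul_ne_zero (Int.cast_ne_zero.2 hk) hσ0)
    refine this.congr fun N => ?_
    congr 1
    ext n
    rw [hx, fourier_coe_eq_expChar, hga, Polynomial.aeval_C, Module.algebraMap_end_apply,
      Pi.smul_apply, smul_eq_mul, mul_assoc]
  have hwindow : ∀ (K : ℕ) (c : Fin (K + 1) → ℤ), ∃ L,
      Tendsto (cesaroMean fun n => ∏ i, fourier (c i) (x (n + i))) atTop (𝓝 L) := by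
    intro K c
    -- The character `c` of the window is the polynomial `∑ c i * X ^ i` in the shift applied to
    -- `g`; the factor `σ` undoes the sign in `a`.
    obtain ⟨L, hL⟩ := ha.exists_tendsto_cesaroMean_expChar
      (∑ i, Polynomial.C (c i * σ) * Polynomial.X ^ (i : ℕ))
    refine ⟨L, hL.congr fun N => ?_⟩
    congr 1
    ext n
    simp only [map_sum, LinearMap.sum_apply, Finset.sum_apply, expChar_sum]
    refine Finset.prod_congr rfl fun i _ => ?_
    rw [hx, fourier_coe_eq_expChar, hga, aeval_seqShift_mul, Polynomial.aeval_C,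
      Module.algebraMap_end_apply, Pi.smul_apply, map_pow, Polynomial.aeval_X, seqShift_pow_apply,
      smul_eq_mul, mul_assoc]
  rintro I ⟨J, hJ, hJ', rfl⟩
  have hfront := haarAddCircle_frontier_image_coe hJ hJ'.nonempty
  have hpattern : ∀ (K : ℕ) (B : Set ℕ), ∃ d : ℝ, HasDensity
      {n : ℕ | ∀ j ∈ Set.Icc 0 K, (n + j ∈ {n : ℕ | circleE (g n) ∈ circleE '' J} ↔ j ∈ B)} d ∧
      Tendsto (cesaroMean ({n : ℕ | ∀ j ∈ Set.Icc 0 K,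
        (x (n + j) ∈ ((↑) : ℝ → UnitAddCircle) '' J ↔ j ∈ B)}.indicator 1)) atTop (𝓝 d) := by
    intro K B
    obtain ⟨d, hd⟩ := exists_tendsto_cesaroMean_pattern hweyl K (hwindow K) hfront B
    refine ⟨d, hasDensity_of_tendsto_cesaroMean (M := M) ?_, hd⟩
    refine hd.congr fun N => ?_
    congr 1
    ext n
    refine Set.indicator_eq_indicator ?_ rfl
    simp only [Set.mem_ofPred_eq, circleE_mem_image_iff, hx, add_right_comm n _ M]
  refine ⟨?_, fun K B _ => ?_⟩
  -- The set itself is the pattern of length one with `B = {0}`.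
  · obtain ⟨d, hd, hd'⟩ := hpattern 0 {0}
    simp only [Set.Icc_self, Set.mem_singleton_iff, forall_eq, add_zero, iff_true] at hd hd'
    exact ⟨d, pos_of_tendsto_cesaroMean_indicator hweyl (nonempty_interior_image_coe hJ hJ') hd', hd⟩
  · obtain ⟨d, hd, -⟩ := hpattern K B
    exact ⟨d, hd⟩
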